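/- A two-valued group is a set $X$ with a multiplication $*\colon X\times X\to \mathrm{Sym}^2(X)$ (values are two-element multisets $[z_1,z_2]$), an identity $e$ and an inverse map $x\mapsto x^{-1}$ such that: $x*(y*z)=(x*y)*z$ as four-element multisets; $e*x=x*e=[x,x]$; $e$ belongs to $x*x^{-1}$ and to $x^{-1}*x$; and if $e$ belongs to $x*y$ or to $y*x$, then $y=x^{-1}$. It is commutative if $x*y=y*x$ for all $x,y$, and involutive if $x^{-1}=x$ for all $x$. In an involutive commutative two-valued group the powers of $x$ are defined by $x^0=e$, $x^1=x$, $x*x^k=[x^{k-1},x^{k+1}]$ for $k\ge 1$, and $\mathrm{ord}\,x\in\{1,2,\dots\}\cup\{\infty\}$ is the least $k\ge1$ with $x^k=e$ ($\infty$ if there is none). Such a two-valued group is special if there are $x,y$ with $\mathrm{ord}\,x>2$, $\mathrm{ord}\,y>2$ such that $x*y$ consists of two identical elements. A topological two-valued group is a two-valued group on a topological space for which $*$ and the inverse are continuous, where $\mathrm{Sym}^2(X)$ has the quotient topology from $X\times X$. An isomorphism of topological two-valued groups is a homeomorphism that respects the multiplication, the identity and the inverse. A Boolean group is a group in which every non-identity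 element has order $2$; $\dim$ denotes its dimension over $\mathbb F_2$. Let $V$ be a discrete Boolean group with $\dim V\ge 2$, $U$ a Hausdorff topological Boolean group, and $s\in U$, $s\ne e$. Put $W=U/\langle s\rangle$ with the quotient topology and let $\pi\colon U\to W$ be the projection. Let $$Y_{V,U,s}=(\{e\}\times U)\sqcup\bigl((V\setminus\{e\})\times W\bigr)$$ (topological disjoint union, product topologies) with the commutative two-valued multiplication $$(e,u_1)*(e,u_2)=[(e,u_1u_2),(e,u_1u_2)],\qquad (e,u)*(v,w)=[(v,\pi(u)w),(v,\pi(u)w)],$$ $$(v,w_1)*(v,w_2)=(e,\pi^{-1}(w_1w_2)),\qquad (v_1,w_1)*(v_2,w_2)=[(v_1v_2,w_1w_2),(v_1v_2,w_1w_2)]\ \text{ for } v_1\ne v_2,$$ where $u,u_1,u_2\in U$, $v,v_1,v_2\in V\setminus\{e\}$, $w,w_1,w_2\in W$, and $(e,\pi^{-1}(w))$ denotes the two-element multiset $[(e,u),(e,su)]$ with $\pi(u)=w$. The identity is $(e,e)$ and every element is its own inverse. **Theorem.** Every special involutive commutative Hausdorff topological two-valued group is isomorphic, as a topological two-valued group,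 to some $Y_{V,U,s}$ with $V,U,s$ as above. Two such topological two-valued groups $Y_{V_1,U_1,s_1}$ and $Y_{V_2,U_2,s_2}$ are isomorphic if and only if $V_1\cong V_2$ as abstract groups and there is an isomorphism of topological groups $U_1\to U_2$ taking $s_1$ to $s_2$. -/

import Mathlib

/-- A two-valued group: a two-valued multiplication with values in the symmetric square
`Sym2 X` (two-element multisets), with associativity (equality of four-element multisets), strong
identity, and existence and uniqueness of inverses. -/
class TwoValuedGroup (X : Type*) where
  /-- The two-valued multiplication. -/
  mul : X → X → Sym2 X
  /-- The identity element. -/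
  one : X
  /-- The inverse. -/
  inv : X → X
  mul_assoc : ∀ x y z : X,
    (mul y z).toMultiset.bind (fun t => (mul x t).toMultiset) =
      (mul x y).toMultiset.bind (fun t => (mul t z).toMultiset)
  one_mul : ∀ x : X, mul one x = s(x, x)
  mul_one : ∀ x : X, mul x one = s(x, x)
  one_mem_mul_inv : ∀ x : X, one ∈ mul x (inv x)
  one_mem_inv_mul : ∀ x : X, one ∈ mul (inv x) x
  eq_inv : ∀ x y : X, one ∈ mul x y ∨ one ∈ mul y x → y = inv x

namespace TwoValuedGroup

/-- The two-valued product. -/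
infixl:70 " ⋆ " => TwoValuedGroup.mul

/-- Commutativity: `x * y = y * x`. -/
def IsCommutative (X : Type*) [TwoValuedGroup X] : Prop :=
  ∀ x y : X, x ⋆ y = y ⋆ x

/-- Involutivity: every element is its own inverse. -/
def IsInvolutive (X : Type*) [TwoValuedGroup X] : Prop :=
  ∀ x : X, inv x = x

open Classical in
/-- The powers of `x`: `x⁰ = e`, `x¹ = x`, and `xᵏ⁺²` is determined by
`x * xᵏ⁺¹ = [xᵏ, xᵏ⁺²]`. In an involutive commutative two-valued group the default value `e` is
never used, see `mul_pow_succ`. -/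
noncomputable def pow {X : Type*} [TwoValuedGroup X] (x : X) : ℕ → X
  | 0 => one
  | 1 => x
  | k + 2 => if h : pow x k ∈ x ⋆ pow x (k + 1) then Sym2.Mem.other h else one

/-- The order of `x`: the least positive `k` with `xᵏ = e`, and `⊤` if there is none. -/
noncomputable def ord {X : Type*} [TwoValuedGroup X] (x : X) : ℕ∞ :=
  ⨅ (k : ℕ) (_ : 0 < k ∧ pow x k = one), (k : ℕ∞)

/-- A special pair: both orders are greater than `2`, but `x * y` consists of two identical
elements. -/
def IsSpecialPair {X : Type*} [TwoValuedGroup X] (x y : X) : Prop :=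
  2 < ord x ∧ 2 < ord y ∧ ∃ z : X, x ⋆ y = s(z, z)

/-- A two-valued group (involutive and commutative wherever this is used) is special if it contains
a special pair. -/
def IsSpecial (X : Type*) [TwoValuedGroup X] : Prop :=
  ∃ x y : X, IsSpecialPair x y

theorem mem_mul_of_mem_mul {X : Type*} [TwoValuedGroup X] (hi : IsInvolutive X)
    {x y z : X} (h : z ∈ x ⋆ y) : x ∈ y ⋆ z := by
  have h1 : (one : X) ∈ (x ⋆ y).toMultiset.bind (fun t => (t ⋆ z).toMultiset) := by
    rw [Multiset.mem_bind]
    refine ⟨z, Sym2.mem_toMultiset.2 h, Sym2.mem_toMultiset.2 ?_⟩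
    have := one_mem_mul_inv z
    rwa [hi z] at this
  rw [← mul_assoc, Multiset.mem_bind] at h1
  obtain ⟨t, ht, ht'⟩ := h1
  rw [Sym2.mem_toMultiset] at ht ht'
  have := eq_inv x t (Or.inl ht')
  rw [hi x] at this
  exact this ▸ ht

/-- The recurrence that characterizes the powers. -/
theorem mul_pow_succ {X : Type*} [TwoValuedGroup X] (hc : IsCommutative X) (hi : IsInvolutive X)
    (x : X) (k : ℕ) : x ⋆ pow x (k + 1) = s(pow x k, pow x (k + 2)) := by
  have key : ∀ k : ℕ, pow x k ∈ x ⋆ pow x (k + 1) := by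
    intro k
    induction k with
    | zero =>
      have := one_mem_mul_inv x
      rw [hi x] at this
      simpa [pow] using this
    | succ k ih =>
      have h2 : pow x (k + 2) ∈ x ⋆ pow x (k + 1) := by
        rw [pow, dif_pos ih]
        exact Sym2.other_mem ih
      rw [hc] at h2
      exact mem_mul_of_mem_mul hi h2
  rw [pow, dif_pos (key k)]
  exact (Sym2.other_spec (key k)).symm

end TwoValuedGroup

/-- A topological two-valued group: the multiplication `X × X → Sym2 X` (where `Sym2 X` carries the
quotient topology of `X × X`) and the inverse are continuous. -/
class IsTopologicalTwoValuedGroup (X : Type*) [TopologicalSpace X] [TwoValuedGroup X] : Prop where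
  continuous_mul : Continuous (fun p : X × X => TwoValuedGroup.mul p.1 p.2)
  continuous_inv : Continuous (TwoValuedGroup.inv : X → X)

/-- An isomorphism of topological two-valued groups: a homeomorphism that respects the
two-valued group structures. -/
structure TopTwoValuedIso (X Y : Type*) [TopologicalSpace X] [TwoValuedGroup X]
    [TopologicalSpace Y] [TwoValuedGroup Y] extends X ≃ₜ Y where
  map_mul : ∀ x y : X,
    TwoValuedGroup.mul (toFun x) (toFun y) = (TwoValuedGroup.mul x y).map toFun
  map_one : toFun TwoValuedGroup.one = TwoValuedGroup.one
  map_inv : ∀ x : X, toFun (TwoValuedGroup.inv x) = TwoValuedGroup.inv (toFun x)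

/-- A (necessarily commutative) group is Boolean if each non-identity element has order `2`. -/
class IsBooleanGroup (G : Type*) [CommGroup G] : Prop where
  orderOf_eq_two : ∀ g : G, g ≠ 1 → orderOf g = 2

theorem IsBooleanGroup.mul_self {G : Type*} [CommGroup G] [IsBooleanGroup G] (g : G) :
    g * g = 1 := by
  by_cases h : g = 1
  · simp [h]
  · rw [← pow_two, ← orderOf_eq_two g h, pow_orderOf_eq_one]

/-- The dimension of a Boolean group as a vector space over the field of two elements. -/
noncomputable def IsBooleanGroup.dim (V : Type*) [CommGroup V] [IsBooleanGroup V] : Cardinal :=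
  letI : Module (ZMod 2) (Additive V) := AddCommGroup.zmodModule fun x => by
    rw [two_nsmul]
    exact IsBooleanGroup.mul_self x.toMul
  Module.rank (ZMod 2) (Additive V)

/-- The set `({e} × U) ⊔ ((V \ {e}) × W)`, where `W = U / ⟨s⟩`. -/
def SpecialY (V U : Type*) [CommGroup V] [CommGroup U] (s : U) : Type _ :=
  U ⊕ ({v : V // v ≠ 1} × (U ⧸ Subgroup.zpowers s))

namespace SpecialY

open IsBooleanGroup

section Algebra

variable {V U : Type*} [CommGroup V] [CommGroup U] {s : U}

/-- The element `(e, u)`. -/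
def ofU (u : U) : SpecialY V U s := Sum.inl u

/-- The element `(v, w)`, where `v ≠ e`. -/
def ofVW (v : {v : V // v ≠ 1}) (w : U ⧸ Subgroup.zpowers s) : SpecialY V U s := Sum.inr (v, w)

theorem fiber_aux [IsBooleanGroup U] (a b : U)
    (h : (QuotientGroup.leftRel (Subgroup.zpowers s)) a b) : s(a, s * a) = s(b, s * b) := by
  rw [QuotientGroup.leftRel_apply] at h
  obtain ⟨k, hk⟩ := h
  have hb : b = s ^ k * a := by
    have hk' : s ^ k = a⁻¹ * b := hk
    rw [hk', mul_comm a⁻¹ b, inv_mul_cancel_right]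
  have hs : s * s = 1 := mul_self s
  rcases Int.even_or_odd' k with ⟨m, rfl | rfl⟩
  · have : b = a := by rw [hb, zpow_mul, zpow_two, hs, one_zpow, one_mul]
    rw [this]
  · have : b = s * a := by rw [hb, zpow_add, zpow_mul, zpow_two, hs, one_zpow, one_mul, zpow_one]
    rw [this, ← mul_assoc, hs, one_mul, Sym2.eq_swap]

/-- The two-element multiset `π⁻¹(w) = [u, su]`, where `π(u) = w` and `π : U → U / ⟨s⟩` is the
projection. -/
def fiber [IsBooleanGroup U] (w : U ⧸ Subgroup.zpowers s) : Sym2 U :=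
  Quotient.lift (fun u : U => s(u, s * u)) fiber_aux w

theorem mul_ne_one_of_ne [IsBooleanGroup V] {a b : V} (h : a ≠ b) : a * b ≠ 1 := by
  intro h'
  apply h
  rw [mul_eq_one_iff_eq_inv.1 h', inv_eq_of_mul_eq_one_left (mul_self b)]

open Classical in
/-- The two-valued multiplication on `SpecialY V U s`. -/
noncomputable def mul [IsBooleanGroup V] [IsBooleanGroup U] :
    SpecialY V U s → SpecialY V U s → Sym2 (SpecialY V U s)
  | .inl u₁, .inl u₂ => s(ofU (u₁ * u₂), ofU (u₁ * u₂))
  | .inl u, .inr (v, w) => s(ofVW v (u * w), ofVW v (u * w))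
  | .inr (v, w), .inl u => s(ofVW v (u * w), ofVW v (u * w))
  | .inr (v₁, w₁), .inr (v₂, w₂) =>
    if h : v₁ = v₂ then (fiber (w₁ * w₂)).map ofU
    else
      s(ofVW ⟨(v₁ : V) * v₂, mul_ne_one_of_ne fun h' => h (Subtype.ext h')⟩ (w₁ * w₂),
        ofVW ⟨(v₁ : V) * v₂, mul_ne_one_of_ne fun h' => h (Subtype.ext h')⟩ (w₁ * w₂))

theorem mul_ofU_ofU [IsBooleanGroup V] [IsBooleanGroup U] (a b : U) :
    mul (ofU a) (ofU b) = s((ofU (a * b) : SpecialY V U s), ofU (a * b)) := rfl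

theorem mul_ofU_ofVW [IsBooleanGroup V] [IsBooleanGroup U] (a : U) (v : {v : V // v ≠ 1})
    (w : U ⧸ Subgroup.zpowers s) :
    mul (ofU a) (ofVW v w) = s((ofVW v (a * w) : SpecialY V U s), ofVW v (a * w)) := rfl

theorem mul_ofVW_ofU [IsBooleanGroup V] [IsBooleanGroup U] (a : U) (v : {v : V // v ≠ 1})
    (w : U ⧸ Subgroup.zpowers s) :
    mul (ofVW v w) (ofU a) = s((ofVW v (a * w) : SpecialY V U s), ofVW v (a * w)) := rfl

theorem mul_ofVW_self [IsBooleanGroup V] [IsBooleanGroup U] (v : {v : V // v ≠ 1})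
    (w₁ w₂ : U ⧸ Subgroup.zpowers s) :
    mul (ofVW v w₁ : SpecialY V U s) (ofVW v w₂) = (fiber (w₁ * w₂)).map ofU :=
  dif_pos rfl

theorem mul_ofVW_ofVW [IsBooleanGroup V] [IsBooleanGroup U] {v₁ v₂ : {v : V // v ≠ 1}}
    (h : v₁ ≠ v₂) (w₁ w₂ : U ⧸ Subgroup.zpowers s) :
    mul (ofVW v₁ w₁ : SpecialY V U s) (ofVW v₂ w₂) =
      s(ofVW ⟨(v₁ : V) * v₂, mul_ne_one_of_ne fun h' => h (Subtype.ext h')⟩ (w₁ * w₂),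
        ofVW ⟨(v₁ : V) * v₂, mul_ne_one_of_ne fun h' => h (Subtype.ext h')⟩ (w₁ * w₂)) :=
  dif_neg h

theorem fiber_mk [IsBooleanGroup U] (u : U) :
    fiber (u : U ⧸ Subgroup.zpowers s) = s(u, s * u) := rfl

theorem mk_s_mul (u : U) :
    ((s * u : U) : U ⧸ Subgroup.zpowers s) = (u : U ⧸ Subgroup.zpowers s) := by
  rw [QuotientGroup.mk_mul, (QuotientGroup.eq_one_iff s).2 (Subgroup.mem_zpowers s), one_mul]

theorem mul_comm' [IsBooleanGroup V] [IsBooleanGroup U] (x y : SpecialY V U s) :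
    mul x y = mul y x := by
  rcases x with a | ⟨v, a⟩ <;> rcases y with b | ⟨w, b⟩
  · change mul (ofU a) (ofU b) = mul (ofU b) (ofU a)
    rw [mul_ofU_ofU, mul_ofU_ofU, mul_comm a b]
  · rfl
  · rfl
  · change mul (ofVW v a) (ofVW w b) = mul (ofVW w b) (ofVW v a)
    by_cases h : v = w
    · subst h
      rw [mul_ofVW_self, mul_ofVW_self, mul_comm a b]
    · rw [mul_ofVW_ofVW h, mul_ofVW_ofVW (Ne.symm h)]
      simp only [mul_comm a b, mul_comm (v : V) w]

theorem ofU_inj {a b : U} : (ofU a : SpecialY V U s) = ofU b ↔ a = b := Sum.inl_injective.eq_iff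

theorem ofU_ne_ofVW (a : U) (v : {v : V // v ≠ 1}) (w : U ⧸ Subgroup.zpowers s) :
    (ofU a : SpecialY V U s) ≠ ofVW v w := Sum.inl_ne_inr

theorem toMultiset_mk {X : Type*} (a b : X) : (s(a, b)).toMultiset = {a, b} := rfl

theorem ind [IsBooleanGroup V] [IsBooleanGroup U] {P : SpecialY V U s → Prop}
    (h₁ : ∀ u, P (ofU u)) (h₂ : ∀ (v : {v : V // v ≠ 1}) (u : U), P (ofVW v u)) (x) : P x := by
  rcases x with a | ⟨v, a⟩
  · exact h₁ a
  · induction a using QuotientGroup.induction_on with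
    | H u => exact h₂ v u

theorem mul_assoc' [IsBooleanGroup V] [IsBooleanGroup U] (x y z : SpecialY V U s) :
    (mul y z).toMultiset.bind (fun t => (mul x t).toMultiset) =
      (mul x y).toMultiset.bind (fun t => (mul t z).toMultiset) := by
  have cancel : ∀ a b : V, a * (a * b) = b := fun a b => by
    rw [← mul_assoc, mul_self, one_mul]
  induction x using ind with
  | h₁ a =>
    induction y using ind with
    | h₁ b =>
      induction z using ind with
      | h₁ c => simp [mul_ofU_ofU, toMultiset_mk, mul_assoc]
      | h₂ v c => simp [mul_ofU_ofU, mul_ofU_ofVW, toMultiset_mk, mul_assoc]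
    | h₂ v b =>
      induction z using ind with
      | h₁ c => simp [mul_ofVW_ofU, mul_ofU_ofVW, toMultiset_mk, mul_left_comm]
      | h₂ w c =>
        by_cases h : v = w
        · subst h
          simp [mul_ofU_ofVW, mul_ofVW_self, mul_ofU_ofU, toMultiset_mk, ← QuotientGroup.mk_mul,
            fiber_mk, mul_left_comm, mul_assoc, Multiset.cons_swap]
        · simp [mul_ofU_ofVW, mul_ofVW_ofVW h, toMultiset_mk, mul_assoc]
  | h₂ u a =>
    induction y using ind with
    | h₁ b =>
      induction z using ind with
      | h₁ c => simp [mul_ofU_ofU, mul_ofVW_ofU, toMultiset_mk, mul_left_comm, mul_assoc]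
      | h₂ v c =>
        by_cases h : u = v
        · subst h
          simp [mul_ofU_ofVW, mul_ofVW_ofU, mul_ofVW_self, toMultiset_mk, mul_left_comm, mul_assoc]
        · simp [mul_ofU_ofVW, mul_ofVW_ofU, mul_ofVW_ofVW h, toMultiset_mk, mul_left_comm,
            mul_assoc]
    | h₂ v b =>
      induction z using ind with
      | h₁ c =>
        by_cases h : u = v
        · subst h
          simp [mul_ofU_ofU, mul_ofVW_ofU, mul_ofVW_self, toMultiset_mk, ← QuotientGroup.mk_mul,
            fiber_mk, mul_left_comm, mul_comm]
          rw [Multiset.cons_swap (ofU (s * _)) (ofU _), Multiset.cons_swap (ofU (s * _)) (ofU _)]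
        · simp [mul_ofVW_ofU, mul_ofVW_ofVW h, toMultiset_mk, mul_left_comm]
      | h₂ w c =>
        by_cases h : u = v
        · subst h
          by_cases h' : u = w
          · subst h'
            simp [mul_ofVW_self, mul_ofU_ofVW, mul_ofVW_ofU, toMultiset_mk,
              ← QuotientGroup.mk_mul, fiber_mk, mk_s_mul, mul_left_comm, mul_comm]
          · have h'' : u ≠ ⟨(u : V) * w, mul_ne_one_of_ne fun e => h' (Subtype.ext e)⟩ := by
              intro e
              have := congrArg Subtype.val e
              exact w.2 (by simpa using this.symm)
            simp [mul_ofVW_self, mul_ofU_ofVW, mul_ofVW_ofVW h', mul_ofVW_ofVW h'', toMultiset_mk,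
              ← QuotientGroup.mk_mul, fiber_mk, mk_s_mul, mul_assoc, cancel]
        · by_cases h' : v = w
          · subst h'
            have h'' : (⟨(u : V) * v, mul_ne_one_of_ne fun e => h (Subtype.ext e)⟩ :
                {v : V // v ≠ 1}) ≠ v := by
              intro e
              have := congrArg Subtype.val e
              exact u.2 (by simpa using this)
            simp [mul_ofVW_self, mul_ofVW_ofU, mul_ofVW_ofVW h, mul_ofVW_ofVW h'', toMultiset_mk,
              ← QuotientGroup.mk_mul, fiber_mk, mk_s_mul, mul_comm, mul_left_comm, mul_self]
          · by_cases h'' : u = ⟨(v : V) * w, mul_ne_one_of_ne fun e => h' (Subtype.ext e)⟩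
            · have e : w = ⟨(u : V) * v, mul_ne_one_of_ne fun e => h (Subtype.ext e)⟩ := by
                apply Subtype.ext
                simp only [h'']
                rw [mul_comm, cancel]
              simp [mul_ofVW_ofVW h, mul_ofVW_ofVW h', toMultiset_mk, ← h'', ← e,
                ← QuotientGroup.mk_mul, mul_ofVW_self, fiber_mk, mul_assoc]
            · have e : (⟨(u : V) * v, mul_ne_one_of_ne fun e => h (Subtype.ext e)⟩ :
                  {v : V // v ≠ 1}) ≠ w := by
                rintro rfl
                apply h''
                apply Subtype.ext
                simp only
                rw [mul_comm (u : V), cancel]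
              simp [mul_ofVW_ofVW h, mul_ofVW_ofVW h', mul_ofVW_ofVW h'', mul_ofVW_ofVW e,
                toMultiset_mk, mul_assoc]

noncomputable instance [IsBooleanGroup V] [IsBooleanGroup U] : TwoValuedGroup (SpecialY V U s) where
  mul := mul
  one := ofU 1
  inv := id
  mul_assoc := mul_assoc'
  one_mul x := by
    induction x using ind with
    | h₁ a => simp [mul_ofU_ofU]
    | h₂ v a => simp [mul_ofU_ofVW]
  mul_one x := by
    induction x using ind with
    | h₁ a => simp [mul_ofU_ofU]
    | h₂ v a => simp [mul_ofVW_ofU]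
  one_mem_mul_inv x := by
    induction x using ind with
    | h₁ a => simp [mul_ofU_ofU, mul_self]
    | h₂ v a =>
      rw [id, mul_ofVW_self, ← QuotientGroup.mk_mul, mul_self, fiber_mk]
      simp
  one_mem_inv_mul x := by
    induction x using ind with
    | h₁ a => simp [mul_ofU_ofU, mul_self]
    | h₂ v a =>
      rw [id, mul_ofVW_self, ← QuotientGroup.mk_mul, mul_self, fiber_mk]
      simp
  eq_inv x y h := by
    have h : ofU 1 ∈ mul x y := by
      rcases h with h | h
      · exact h
      · rwa [mul_comm']
    have eq_of : ∀ a b : U, a * b = 1 → b = a := fun a b e => by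
      rw [← mul_right_inj a, e, mul_self]
    induction x using ind with
    | h₁ a =>
      induction y using ind with
      | h₁ b =>
        have : (1 : U) = a * b := by simpa [mul_ofU_ofU, ofU_inj] using h
        rw [eq_of a b this.symm, id]
      | h₂ w b => simp [mul_ofU_ofVW, ofU_ne_ofVW] at h
    | h₂ v a =>
      induction y using ind with
      | h₁ b => simp [mul_ofVW_ofU, ofU_ne_ofVW] at h
      | h₂ w b =>
        by_cases e : v = w
        · subst e
          have h' : 1 = a * b ∨ 1 = s * (a * b) := by
            rw [mul_ofVW_self, ← QuotientGroup.mk_mul, fiber_mk, Sym2.map_mk, Sym2.mem_iff] at h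
            simpa only [ofU_inj] using h
          rcases h' with h' | h'
          · rw [eq_of a b h'.symm, id]
          · rw [← mul_assoc] at h'
            rw [eq_of _ b h'.symm, mk_s_mul, id]
        · simp [mul_ofVW_ofVW e, ofU_ne_ofVW] at h

end Algebra

section Topology

variable {V U : Type*} [CommGroup V] [CommGroup U] {s : U} [TopologicalSpace U]

/-- The topology of the disjoint union `U ⊔ ((V \ {e}) × W)`, where `V` is discrete and
`W = U / ⟨s⟩` has the quotient topology. -/
instance : TopologicalSpace (SpecialY V U s) :=
  letI : TopologicalSpace V := ⊥
  inferInstanceAs (TopologicalSpace (U ⊕ ({v : V // v ≠ 1} × (U ⧸ Subgroup.zpowers s))))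

theorem continuous_ofU : Continuous (ofU : U → SpecialY V U s) :=
  letI : TopologicalSpace V := ⊥
  continuous_inl (Y := {v : V // v ≠ 1} × (U ⧸ Subgroup.zpowers s))

theorem continuous_ofVW (v : {v : V // v ≠ 1}) :
    Continuous (ofVW v : U ⧸ Subgroup.zpowers s → SpecialY V U s) := by
  let : TopologicalSpace V := ⊥
  exact (continuous_inr (X := U)).comp (Continuous.prodMk_right v)

instance [IsBooleanGroup U] [IsTopologicalGroup U] [T2Space U] : T2Space (SpecialY V U s) := by
  let : TopologicalSpace V := ⊥
  have : DiscreteTopology V := ⟨rfl⟩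
  have : IsClosed (Subgroup.zpowers s : Set U) := by
    have hf : IsOfFinOrder s := isOfFinOrder_iff_pow_eq_one.2 ⟨2, two_pos, by
      rw [pow_two, mul_self]⟩
    exact (finite_zpowers.2 hf).isClosed
  exact inferInstanceAs (T2Space (U ⊕ ({v : V // v ≠ 1} × (U ⧸ Subgroup.zpowers s))))

theorem continuous_dom {Z : Type*} [TopologicalSpace Z]
    {f : SpecialY V U s × SpecialY V U s → Z}
    (h₁ : Continuous fun p : U × U => f (ofU p.1, ofU p.2))
    (h₂ : ∀ v, Continuous fun p : U × (U ⧸ Subgroup.zpowers s) => f (ofU p.1, ofVW v p.2))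
    (h₃ : ∀ v, Continuous fun p : (U ⧸ Subgroup.zpowers s) × U => f (ofVW v p.1, ofU p.2))
    (h₄ : ∀ v w, Continuous fun p : (U ⧸ Subgroup.zpowers s) × (U ⧸ Subgroup.zpowers s) =>
      f (ofVW v p.1, ofVW w p.2)) : Continuous f := by
  let : TopologicalSpace V := ⊥
  have : DiscreteTopology V := ⟨rfl⟩
  have hU : Topology.IsOpenEmbedding (ofU : U → SpecialY V U s) :=
    Topology.IsOpenEmbedding.inl (Y := {v : V // v ≠ 1} × (U ⧸ Subgroup.zpowers s))
  have hV : ∀ v, Topology.IsOpenEmbedding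
      (ofVW v : U ⧸ Subgroup.zpowers s → SpecialY V U s) := fun v => by
    refine (Topology.IsOpenEmbedding.inr (X := U)
      (Y := {v : V // v ≠ 1} × (U ⧸ Subgroup.zpowers s))).comp
      (.of_continuous_injective_isOpenMap (Continuous.prodMk_right v)
        (Prod.mk_right_injective v) fun O hO => ?_)
    have : (fun w => (v, w)) '' O = {v} ×ˢ O := by
      ext ⟨a, b⟩
      simp [eq_comm, and_comm]
    rw [this]
    exact (isOpen_discrete _).prod hO
  rw [continuous_iff_continuousAt]
  rintro ⟨a | ⟨v, a⟩, b | ⟨w, b⟩⟩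
  · exact ((hU.prodMap hU).continuousAt_iff (x := (a, b))).1 h₁.continuousAt
  · exact ((hU.prodMap (hV w)).continuousAt_iff (x := (a, b))).1 (h₂ w).continuousAt
  · exact (((hV v).prodMap hU).continuousAt_iff (x := (a, b))).1 (h₃ v).continuousAt
  · exact (((hV v).prodMap (hV w)).continuousAt_iff (x := (a, b))).1 (h₄ v w).continuousAt

theorem continuous_sym2Mk {X : Type*} [TopologicalSpace X] :
    Continuous fun p : X × X => s(p.1, p.2) := continuous_quot_mk

instance [IsBooleanGroup V] [IsBooleanGroup U] [IsTopologicalGroup U] :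
    IsTopologicalTwoValuedGroup (SpecialY V U s) where
  continuous_inv := continuous_id
  continuous_mul := by
    have hπ : Continuous fun u : U => (u : U ⧸ Subgroup.zpowers s) := continuous_quot_mk
    have hfib : Continuous fun w : U ⧸ Subgroup.zpowers s =>
        ((fiber w).map ofU : Sym2 (SpecialY V U s)) := by
      refine isQuotientMap_quot_mk.continuous_iff.2 ?_
      have h : Continuous fun u : U => ((ofU u : SpecialY V U s), (ofU (s * u) : SpecialY V U s)) :=
        continuous_ofU.prodMk (continuous_ofU.comp (continuous_const.mul continuous_id))
      exact continuous_sym2Mk.comp h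
    refine continuous_dom ?_ (fun v => ?_) (fun v => ?_) (fun v w => ?_)
    · exact continuous_sym2Mk.comp ((continuous_ofU.comp continuous_mul).prodMk
        (continuous_ofU.comp continuous_mul))
    · have h : Continuous fun p : U × (U ⧸ Subgroup.zpowers s) =>
          (ofVW v (p.1 * p.2) : SpecialY V U s) :=
        (continuous_ofVW v).comp ((hπ.comp continuous_fst).mul continuous_snd)
      exact continuous_sym2Mk.comp (h.prodMk h)
    · have h : Continuous fun p : (U ⧸ Subgroup.zpowers s) × U =>
          (ofVW v (p.2 * p.1) : SpecialY V U s) :=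
        (continuous_ofVW v).comp ((hπ.comp continuous_snd).mul continuous_fst)
      exact continuous_sym2Mk.comp (h.prodMk h)
    · by_cases e : v = w
      · subst e
        exact (hfib.comp continuous_mul).congr fun p => (mul_ofVW_self v p.1 p.2).symm
      · have h := (continuous_ofVW (s := s) ⟨(v : V) * w,
          mul_ne_one_of_ne fun h' => e (Subtype.ext h')⟩).comp
          (continuous_mul (M := U ⧸ Subgroup.zpowers s))
        exact (continuous_sym2Mk.comp (h.prodMk h)).congr fun p =>
          (mul_ofVW_ofVW e p.1 p.2).symm

end Topology

end SpecialY

universe u v₁ u₁ v₂ u₂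

/-!
Let `X` be an involutive commutative two-valued group. The argument takes place in the rational
algebra `Alg X` with basis `X`, where the product of basis elements `x`, `y` with `x ⋆ y = [a, b]`
is `(a + b) / 2`. It is a commutative ring with unit `e`, so two-valued identities can be
manipulated by ring arithmetic and then read off by comparing coefficients.

Elements with `u² = e` act on `X` by single-valued multiplication (`mul_eq_act`) and form a
Boolean group `U` (`Invol X`). If `x`, `y` is a special pair with `x ⋆ y = [z, z]`, then
`(1 + x²)(1 + y²) = 2 + 2z²` in the algebra, and counting the coefficient of `e` gives
`x² = y² = z² = s` with `s² = e` (`pow_two_eq_of_mul_eq`). Multiplication by an element whose square is `s` always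
gives a full orbit `[a, sa]` (`mul_eq_orbit`). The decisive fact is that *every* square in `X` is
`e` or `s` (`pow_two_eq_one_or`). Suppose `T = t²` were neither. The elements of `t ⋆ x`, `t ⋆ y`,
`t ⋆ z` have square `T` or `sT`, so two of these three squares agree. Agreement forces `sT = T`
and `T ∈ Uz`, or the same with `x` or `y` instead of `z` (`pow_two_mem_orbit`). But `sT = T` makes
all three squares agree, so that `T = hz = h'x` with `h`, `h'` in `U`. Multiplying by `x` gives
`hy = h'x² = (h' + sh') / 2` in the algebra, hence `h' = sh'` and `s = e`, a contradiction.

Consequently the set of orbits of `s` is an ordinary Boolean group (`Orbits s`), which contains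
`W = U / ⟨s⟩`; outside `U` the orbits of `s` are single points. Splitting off `V = Orbits s / W`,
which is possible for vector spaces, identifies `X` with the model (`fromY`). Continuity of the
multiplication shows that for an open set `O` the condition `x ⋆ y ⊆ O` on `(x, y)` is open; hence
`U` is open and closed, the action of `U` is continuous, and the identification is open
(`fromY_isOpenMap`).

Conversely `U`, `s` and `V` can be recovered from the model: `U` is the set of `x` with
`x ⋆ x = [e, e]`, `s` is the non-trivial value of `x ⋆ x` for `x` outside `U`, and the projection to `V` is
determined by the condition that `x`, `y` have the same image exactly if `x ⋆ y` meets `U`.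
-/

namespace TwoValuedGroup

variable {X : Type*} [TwoValuedGroup X]

/-! ### The algebra of a two-valued group -/

/-- The rational hypergroup algebra of a two-valued group: the vector space with basis `X`, in which
the product of two basis elements `x`, `y` with `x ⋆ y = [a, b]` is `(a + b) / 2`. -/
def Alg (X : Type*) [TwoValuedGroup X] : Type _ := X →₀ ℚ

namespace Alg

noncomputable instance : AddCommGroup (Alg X) := inferInstanceAs (AddCommGroup (X →₀ ℚ))

noncomputable instance : Module ℚ (Alg X) := inferInstanceAs (Module ℚ (X →₀ ℚ))

/-- The basis element of `Alg X` given by an element of `X`. -/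
noncomputable def of (x : X) : Alg X := Finsupp.single x (1 : ℚ)

/-- The coefficient at a given basis element. -/
noncomputable def coeff (c : X) : Alg X →ₗ[ℚ] ℚ := Finsupp.lapply c

open Classical in
theorem coeff_of (c x : X) : coeff c (of x) = if x = c then 1 else 0 :=
  Finsupp.single_apply

/-- The linear extension of a map defined on the basis `X` of `Alg X`. -/
noncomputable def extend {M : Type*} [AddCommGroup M] [Module ℚ M] (f : X → M) : Alg X →ₗ[ℚ] M :=
  Finsupp.linearCombination ℚ f

theorem extend_of {M : Type*} [AddCommGroup M] [Module ℚ M] (f : X → M) (x : X) :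
    extend f (of x) = f x :=
  (Finsupp.linearCombination_single ℚ (1 : ℚ) x).trans (one_smul ℚ _)

@[elab_as_elim]
theorem induction_of {P : Alg X → Prop} (a : Alg X) (zero : P 0)
    (add : ∀ a b, P a → P b → P (a + b)) (smul_of : ∀ (r : ℚ) (x : X), P (r • of x)) : P a := by
  refine Finsupp.induction_linear a zero add fun x r => ?_
  have h : (Finsupp.single x r : Alg X) = r • of x := by
    unfold of
    exact (Finsupp.smul_single_one x r).symm
  exact h ▸ smul_of r x

/-- The product of `Alg X` as a bilinear map. -/
noncomputable def mulHom : Alg X →ₗ[ℚ] Alg X →ₗ[ℚ] Alg X :=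
  extend fun x => extend fun y => (1 / 2 : ℚ) • ((x ⋆ y).toMultiset.map of).sum

noncomputable instance : Mul (Alg X) := ⟨fun a b => mulHom a b⟩

noncomputable instance : One (Alg X) := ⟨of one⟩

theorem mul_def (a b : Alg X) : a * b = mulHom a b := rfl

theorem of_one : of (one : X) = 1 := rfl

theorem of_mul_of (x y : X) :
    of x * of y = (1 / 2 : ℚ) • ((x ⋆ y).toMultiset.map of).sum := by
  rw [mul_def, mulHom, extend_of, extend_of]

theorem sum_map_smul {ι : Type*} (r : ℚ) (m : Multiset ι) (f : ι → Alg X) :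
    (m.map fun i => r • f i).sum = r • (m.map f).sum :=
  by rw [Multiset.smul_sum, Multiset.map_map]; rfl

theorem mul_multiset_sum (a : Alg X) (m : Multiset (Alg X)) :
    a * m.sum = (m.map (a * ·)).sum := map_multiset_sum (mulHom a) m

theorem multiset_sum_mul (a : Alg X) (m : Multiset (Alg X)) :
    m.sum * a = (m.map (· * a)).sum := map_multiset_sum (mulHom.flip a) m

theorem mul_smul' (r : ℚ) (a b : Alg X) : a * (r • b) = r • (a * b) := by
  simp [mul_def]

theorem smul_mul' (r : ℚ) (a b : Alg X) : (r • a) * b = r • (a * b) := by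
  simp [mul_def]

/-- On basis elements, associativity is the equality of four-element multisets, summed up. -/
theorem of_mul_assoc (x y z : X) : of x * of y * of z = of x * (of y * of z) := by
  have h := congrArg (fun m => (m.map (of : X → Alg X)).sum) (mul_assoc x y z)
  simp only [Multiset.map_bind, Multiset.sum_bind] at h
  rw [of_mul_of x y, of_mul_of y z, smul_mul', mul_smul', mul_multiset_sum, multiset_sum_mul]
  simp only [Multiset.map_map, Function.comp_def, of_mul_of, sum_map_smul]
  rw [h]

noncomputable instance : Ring (Alg X) where
  __ := (inferInstance : AddCommGroup (Alg X))
  left_distrib a b c := by simp [mul_def]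
  right_distrib a b c := by simp [mul_def]
  zero_mul a := by simp [mul_def]
  mul_zero a := by simp [mul_def]
  mul_assoc a b c := by
    induction a using induction_of with
    | zero => simp [mul_def]
    | add a a' h h' =>
      simp only [mul_def, map_add, LinearMap.add_apply] at *
      rw [h, h']
    | smul_of r x =>
      induction b using induction_of with
      | zero => simp [mul_def]
      | add b b' h h' =>
        simp only [mul_def, map_add, LinearMap.add_apply] at *
        rw [h, h']
      | smul_of r' y =>
        induction c using induction_of with
        | zero => simp [mul_def]
        | add c c' h h' =>
          simp only [mul_def, map_add] at *
          rw [h, h']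
        | smul_of r'' z => simp only [smul_mul', mul_smul', of_mul_assoc]
  one_mul a := by
    induction a using induction_of with
    | zero => simp [mul_def]
    | add a b h h' => rw [mul_def, map_add, ← mul_def, ← mul_def, h, h']
    | smul_of r x =>
      rw [mul_smul', ← of_one, of_mul_of, TwoValuedGroup.one_mul, SpecialY.toMultiset_mk]
      simp [← two_smul ℚ, smul_smul]
  mul_one a := by
    induction a using induction_of with
    | zero => simp [mul_def]
    | add a b h h' =>
      rw [mul_def, map_add, LinearMap.add_apply, ← mul_def, ← mul_def, h, h']
    | smul_of r x =>
      rw [smul_mul', ← of_one, of_mul_of, TwoValuedGroup.mul_one, SpecialY.toMultiset_mk]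
      simp [← two_smul ℚ, smul_smul]

noncomputable instance [hc : Fact (IsCommutative X)] : CommRing (Alg X) where
  mul_comm a b := by
    induction a using induction_of with
    | zero => simp
    | add a a' h h' => rw [add_mul, mul_add, h, h']
    | smul_of r x =>
      induction b using induction_of with
      | zero => simp
      | add b b' h h' => rw [add_mul, mul_add, h, h']
      | smul_of r' y =>
        simp only [smul_mul', mul_smul', of_mul_of, hc.out x y]
        rw [smul_comm]

/-- The defining relation of the product, cleared of denominators so that `linear_combination`
can use it. -/
theorem two_mul_of_mul_of {x y a b : X} (h : x ⋆ y = s(a, b)) :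
    2 * (of x * of y) = of a + of b := by
  rw [of_mul_of, h, SpecialY.toMultiset_mk, two_mul, ← two_smul ℚ, smul_smul]
  simp

theorem of_injective : Function.Injective (of : X → Alg X) :=
  Finsupp.single_left_injective one_ne_zero

theorem sym2_eq_of_add_eq {a b c d : X} (h : of a + of b = of c + of d) : s(a, b) = s(c, d) := by
  rw [Sym2.eq_iff]
  by_cases hac : a = c
  · subst hac
    exact Or.inl ⟨rfl, of_injective (add_left_cancel h)⟩
  by_cases had : a = d
  · subst had
    rw [add_comm] at h
    exact Or.inr ⟨rfl, of_injective (add_right_cancel h)⟩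
  have h1 := congrArg (coeff a) h
  simp only [map_add, coeff_of, if_neg (Ne.symm hac), if_neg (Ne.symm had)] at h1
  split_ifs at h1 <;> norm_num at h1

/-- Products can be read off from the algebra. -/
theorem mul_eq_of_two_mul {x y a b : X} (h : 2 * (of x * of y) = of a + of b) :
    x ⋆ y = s(a, b) := by
  induction hm : x ⋆ y using Sym2.ind with
  | _ c d => exact sym2_eq_of_add_eq ((two_mul_of_mul_of hm).symm.trans h)

theorem coeff_two_mul (c : X) (a : Alg X) : coeff c (2 * a) = 2 * coeff c a := by
  rw [two_mul, map_add, two_mul]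

theorem coeff_four_mul (c : X) (a : Alg X) : coeff c (4 * a) = 4 * coeff c a := by
  rw [show (4 : Alg X) * a = (a + a) + (a + a) by noncomm_ring]
  simp only [map_add]
  ring

theorem two_mul_cancel {a b : Alg X} (h : 2 * a = 2 * b) : a = b := by
  rw [two_mul, two_mul, ← two_smul ℚ, ← two_smul ℚ b] at h
  exact smul_right_injective _ two_ne_zero h

end Alg
end TwoValuedGroup

namespace TwoValuedGroup
open Alg

variable {X : Type*} [TwoValuedGroup X]

/-! ### Elements of order at most two -/

theorem eq_of_four_mul_eq {a b c d y : X} (h : of a + of b + of c + of d = 4 * of y) :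
    a = y ∧ b = y ∧ c = y ∧ d = y := by
  have h1 := congrArg (coeff y) h
  simp only [map_add, coeff_of, coeff_four_mul, if_true] at h1
  split_ifs at h1 <;> norm_num at h1
  exact ⟨‹_›, ‹_›, ‹_›, ‹_›⟩

theorem exists_mem_mul (x y : X) : ∃ z, z ∈ x ⋆ y := ⟨_, Sym2.out_fst_mem _⟩

section

variable [hi : Fact (IsInvolutive X)]

theorem mem_mul_rotate {x y z : X} (h : z ∈ x ⋆ y) : x ∈ y ⋆ z :=
  mem_mul_of_mem_mul hi.out h

theorem eq_of_one_mem {x y : X} (h : one ∈ x ⋆ y) : x = y :=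
  ((eq_inv x y (Or.inl h)).trans (hi.out x)).symm

end

section

variable [hc : Fact (IsCommutative X)] [hi : Fact (IsInvolutive X)]

theorem mul_self_eq (x : X) : x ⋆ x = s(one, pow x 2) := mul_pow_succ hc.out hi.out x 0

theorem two_mul_of_sq (x : X) : 2 * (of x * of x) = 1 + of (pow x 2) :=
  two_mul_of_mul_of (mul_self_eq x)

theorem pow_two_mem (x : X) : pow x 2 ∈ x ⋆ x := by
  rw [mul_self_eq]
  exact Sym2.mem_mk_right _ _

theorem of_sq_eq_one {u : X} (hu : pow u 2 = one) : of u * of u = 1 := by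
  apply two_mul_cancel
  rw [two_mul_of_sq, hu, of_one]
  ring

theorem pow_two_eq_one_of_mul_self {u : X} (hu : of u * of u = 1) : pow u 2 = one := by
  have h := two_mul_of_sq u
  rw [hu] at h
  apply of_injective
  rw [of_one]
  linear_combination -h

theorem pow_two_eq_of_two_mul {x p : X} (h : 2 * (of x * of x) = 1 + of p) : pow x 2 = p := by
  apply of_injective
  linear_combination h - two_mul_of_sq x

/-- The action of elements of order at most two: a choice of one of the two values of `u ⋆ x`, which
coincide if `u² = e`. -/
noncomputable def act (u x : X) : X := (Quot.out (u ⋆ x)).1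

/-- Multiplication by `u` with `u² = e` is single-valued: if `u ⋆ x = [a, b]`, then
`u * (u * x) = x` forces `u * a` and `u * b` to be `x`. -/
theorem mul_eq_act {u : X} (hu : pow u 2 = one) (x : X) : u ⋆ x = s(act u x, act u x) := by
  suffices h : ∃ z, u ⋆ x = s(z, z) by
    obtain ⟨z, hz⟩ := h
    have h1 : s((Quot.out (u ⋆ x)).1, (Quot.out (u ⋆ x)).2) = s(z, z) :=
      (Quot.out_eq (u ⋆ x)).trans hz
    have h2 : act u x = z := by
      rcases Sym2.eq_iff.1 h1 with h | h <;> exact h.1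
    rw [h2, hz]
  induction hz : u ⋆ x using Sym2.ind with | _ a b
  induction h1 : u ⋆ a using Sym2.ind with | _ a₁ a₂
  induction h2 : u ⋆ b using Sym2.ind with | _ b₁ b₂
  replace hz := two_mul_of_mul_of hz
  replace h1 := two_mul_of_mul_of h1
  replace h2 := two_mul_of_mul_of h2
  have huu := of_sq_eq_one hu
  have h4 : of a₁ + of a₂ + of b₁ + of b₂ = 4 * of x := by
    linear_combination -h1 - h2 - 2 * of u * hz + 4 * of x * huu
  obtain ⟨rfl, rfl, rfl, rfl⟩ := eq_of_four_mul_eq h4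
  refine ⟨a, ?_⟩
  have ha : of a = of b := by
    apply two_mul_cancel
    linear_combination of u * h1 - of u * h2 + (2 * of b - 2 * of a) * huu
  rw [of_injective ha]

theorem of_act {u : X} (hu : pow u 2 = one) (x : X) : of (act u x) = of u * of x := by
  apply two_mul_cancel
  rw [two_mul_of_mul_of (mul_eq_act hu x), two_mul]

theorem eq_act_of_mem {u x z : X} (hu : pow u 2 = one) (h : z ∈ u ⋆ x) : z = act u x := by
  rw [mul_eq_act hu] at h
  simpa using h

theorem act_act {u : X} (hu : pow u 2 = one) (x : X) : act u (act u x) = x := by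
  apply of_injective
  rw [of_act hu, of_act hu]
  linear_combination of x * of_sq_eq_one hu

theorem pow_two_act {u v : X} (hu : pow u 2 = one) (hv : pow v 2 = one) :
    pow (act u v) 2 = one := by
  apply pow_two_eq_one_of_mul_self
  rw [of_act hu]
  linear_combination of v * of v * of_sq_eq_one hu + of_sq_eq_one hv

/-- If `x² = s` has order two, then `s` fixes `x`. -/
theorem act_eq_self {s x : X} (hs : pow s 2 = one) (hx : pow x 2 = s) : of s * of x = of x := by
  have h := pow_two_mem x
  rw [hx] at h
  replace h := mem_mul_rotate h
  rw [hc.out] at h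
  rw [← of_act hs, ← eq_act_of_mem hs h]

/-! ### Special pairs -/

/-- Squaring `x ⋆ y = [z, z]` in the algebra gives `(1 + x²)(1 + y²) = 2 + 2z²`, and comparing
the coefficients of the identity forces `x²` and `y²` to be inverse to each other. -/
theorem pow_two_eq_of_mul_eq {x y z : X} (h : x ⋆ y = s(z, z)) (hx : pow x 2 ≠ one)
    (hy : pow y 2 ≠ one) :
    pow y 2 = pow x 2 ∧ pow z 2 = pow x 2 ∧ pow (pow x 2) 2 = one := by
  have h1 := two_mul_of_mul_of h
  have h2 := two_mul_of_sq x
  have h3 := two_mul_of_sq y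
  have h4 := two_mul_of_sq z
  induction h5 : pow x 2 ⋆ pow y 2 using Sym2.ind with | _ a b
  have h6 := two_mul_of_mul_of h5
  have h7 : 2 * of one + 2 * of (pow x 2) + 2 * of (pow y 2) + (of a + of b) =
      4 * of one + 4 * of (pow z 2) := by
    rw [of_one]
    linear_combination -h6 - 4 * of x * of x * h3 - 2 * (1 + of (pow y 2)) * h2
      + 2 * (2 * of x * of y + 2 * of z) * h1 + 4 * h4
  have h8 := congrArg (coeff one) h7
  simp only [map_add, coeff_of, coeff_four_mul, coeff_two_mul, if_true, if_neg hx, if_neg hy] at h8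
  have hab : a = one ∧ b = one := by
    split_ifs at h8 <;> norm_num at h8
    exact ⟨‹_›, ‹_›⟩
  obtain ⟨rfl, rfl⟩ := hab
  have hxy : pow x 2 = pow y 2 := eq_of_one_mem (h5 ▸ Sym2.mem_mk_left _ _)
  rw [← hxy] at h6 h7 ⊢
  refine ⟨rfl, ?_, pow_two_eq_of_two_mul (by rw [h6, of_one])⟩
  apply of_injective
  apply two_mul_cancel
  apply two_mul_cancel
  linear_combination -h7

/-- If `x² = s` has order two, then any product `t ⋆ x` is an orbit of `s`, possibly
one point counted twice. -/
theorem mul_eq_orbit {s x t a : X} (hs : pow s 2 = one) (hx : pow x 2 = s) (ha : a ∈ t ⋆ x) :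
    t ⋆ x = s(a, act s a) := by
  have hxs := act_eq_self hs hx
  have hss := of_sq_eq_one hs
  have hxx := two_mul_of_sq x
  rw [hx] at hxx
  have ht : t ∈ a ⋆ x := by
    rw [hc.out]
    exact mem_mul_rotate ha
  obtain ⟨b, hb⟩ := ha
  obtain ⟨r, hr⟩ := ht
  have h1 := two_mul_of_mul_of hb
  have h2 := two_mul_of_mul_of hr
  have h3 : s(act s a, act s b) = s(a, b) := by
    apply sym2_eq_of_add_eq
    rw [of_act hs, of_act hs]
    linear_combination (1 - of s) * h1 + 2 * of t * hxs
  -- `s` fixes `x`, so it permutes the two values of `t ⋆ x`; if it fixes both of them, the values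
  -- must be equal, which follows by multiplying with `x` once more
  rcases Sym2.eq_iff.1 h3 with ⟨h4, -⟩ | ⟨h4, -⟩
  · have h6 : s(act s t, act s r) = s(t, r) := by
      apply sym2_eq_of_add_eq
      rw [of_act hs, of_act hs]
      linear_combination (1 - of s) * h2 + 2 * of a * hxs
    rw [hb]
    congr 2
    rcases Sym2.eq_iff.1 h6 with ⟨h7, -⟩ | ⟨h7, -⟩
    · induction h8 : b ⋆ x using Sym2.ind with | _ b₁ b₂
      have h9 := two_mul_of_mul_of h8
      have h10 : of s * of t = of t := by rw [← of_act hs, h7]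
      have h11 : of t + of r + of b₁ + of b₂ = 4 * of t := by
        linear_combination -h2 - h9 - 2 * of x * h1 + 2 * of t * hxx + 2 * h10
      obtain ⟨-, rfl, -, -⟩ := eq_of_four_mul_eq h11
      rw [h4]
      have h12 : of s * of a = of a := by rw [← of_act hs, h4]
      apply of_injective
      linear_combination -h1 - of x * h2 + of a * hxx + h12
    · rw [← h7, of_act hs] at h2
      apply of_injective
      rw [of_act hs]
      linear_combination -h1 - of x * h2 + of a * hxx - of t * hxs
  · rw [hb, h4]

/-- Obtained by squaring the relation `2 t x = (1 + s) a`. -/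
theorem pow_two_of_mem {s x t a : X} (hs : pow s 2 = one) (hx : pow x 2 = s) (ha : a ∈ t ⋆ x) :
    pow a 2 = pow t 2 ∨ pow a 2 = act s (pow t 2) := by
  have h1 := two_mul_of_mul_of (mul_eq_orbit hs hx ha)
  rw [of_act hs] at h1
  have hss := of_sq_eq_one hs
  have hxx := two_mul_of_sq x
  rw [hx] at hxx
  have htt := two_mul_of_sq t
  have haa := two_mul_of_sq a
  have h2 : s(pow a 2, act s (pow a 2)) = s(pow t 2, act s (pow t 2)) := by
    apply sym2_eq_of_add_eq
    rw [of_act hs, of_act hs]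
    linear_combination -(1 + of s) * haa - (2 * of t * of x + of a * (1 + of s)) * h1
      + 2 * of t * of t * hxx + (1 + of s) * htt - of a * of a * hss
  rcases Sym2.eq_iff.1 h2 with h | h
  · exact Or.inl h.1
  · exact Or.inr h.1

/-! ### All squares are `e` or `s` -/

/-- The heart of the matter: if `x * y = [z, z]` and some `t` had `t² ∉ {e, s}`, then, as soon as
`t ⋆ x` and `t ⋆ y` contain elements with the same square, `t²` is fixed by `s` and lies in the
orbit of `z` under the elements of order at most two. -/
theorem pow_two_mem_orbit {s x y z t a c : X} (hs : pow s 2 = one) (hs1 : s ≠ one)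
    (hx : pow x 2 = s) (hy : pow y 2 = s) (hz : pow z 2 = s) (hxy : of x * of y = of z)
    (ht1 : pow t 2 ≠ one) (hts : pow t 2 ≠ s) (ha : a ∈ t ⋆ x) (hcy : c ∈ t ⋆ y)
    (hac : pow a 2 = pow c 2) :
    act s (pow t 2) = pow t 2 ∧ ∃ h, pow h 2 = one ∧ pow t 2 = act h z := by
  have hss := of_sq_eq_one hs
  have hzs := act_eq_self hs hz
  have hat := pow_two_of_mem hs hx ha
  have h1 := two_mul_of_mul_of (mul_eq_orbit hs hx ha)
  have h2 := two_mul_of_mul_of (mul_eq_orbit hs hy hcy)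
  have htt := two_mul_of_sq t
  have haa := two_mul_of_sq a
  have hcc := two_mul_of_sq c
  have hzz := two_mul_of_sq z
  rw [← hac] at hcc
  rw [hz] at hzz
  rw [of_act hs] at h1 h2
  generalize hT : pow t 2 = T at *
  generalize hA : pow a 2 = A at *
  have hsT1 : act s T ≠ one := fun h => hts (of_injective (by
    have h' : of s * of T = 1 := by rw [← of_act hs, h, of_one]
    linear_combination of s * h' - of T * hss))
  -- `(tx)(ty) = t² z` says that the orbits of the values of `a ⋆ c` are those of `z` and `T ⋆ z`
  have hzac : z ∈ a ⋆ c := by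
    induction h3 : a ⋆ c using Sym2.ind with | _ g h
    induction h4 : T ⋆ z using Sym2.ind with | _ w₁ w₂
    have h5 := two_mul_of_mul_of h3
    have h6 := two_mul_of_mul_of h4
    have h7 : 2 * of z + of w₁ + of w₂ = of g + of (act s g) + of h + of (act s h) := by
      rw [of_act hs, of_act hs]
      linear_combination -h6 + (1 + of s) * h5 - 2 * of z * htt - 4 * of t * of t * hxy
        + 2 * of t * of y * h1 + of a * (1 + of s) * h2 + of a * of c * hss
    have h8 := congrArg (coeff z) h7
    have hfix : ∀ k, act s k = z → k = z := fun k hk => by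
      rw [← act_act hs k, hk]
      apply of_injective
      rw [of_act hs, hzs]
    simp only [map_add, coeff_of, coeff_two_mul, if_true] at h8
    rw [Sym2.mem_iff]
    by_contra! hne
    rw [if_neg hne.1.symm, if_neg hne.2.symm, if_neg (fun h => hne.1.symm (hfix _ h)),
      if_neg (fun h => hne.2.symm (hfix _ h))] at h8
    split_ifs at h8 <;> norm_num at h8
  obtain ⟨h, hh⟩ := hzac
  replace hh := two_mul_of_mul_of hh
  have hTz : 2 * (of T * of z) = of h + of (act s h) := by
    rw [of_act hs]
    linear_combination (1 + of s) * hh - 2 * of z * htt - 4 * of t * of t * hxy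
        + 2 * of t * of y * h1 + of a * (1 + of s) * h2 + of a * of c * hss + hzs
  have hH := two_mul_of_sq h
  have hA2 := two_mul_of_sq A
  -- the square of the relation `2 a c = z + h`
  have h9 : of one + 4 * of A + of (pow A 2) =
      of s + 2 * of T + 2 * of (act s T) + of (pow h 2) := by
    rw [of_act hs] at hTz ⊢
    rw [of_one]
    linear_combination -4 * of c * of c * haa - 2 * (1 + of A) * hcc
      + 2 * (2 * of a * of c + of z + of h) * hh - hA2 + (1 + 2 * of T) * hzz + hH
      - 2 * of z * hTz - 2 * of h * hzs
  -- the coefficient of `e` is positive on the left, and only `h²` can provide it on the right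
  have hA1 : A ≠ one := by
    rcases hat with h | h <;> rw [h] <;> assumption
  have hh1 : pow h 2 = one := by
    have h10 := congrArg (coeff one) h9
    simp only [map_add, coeff_of, coeff_two_mul, coeff_four_mul, if_true, if_neg hA1, if_neg hs1,
      if_neg ht1, if_neg hsT1] at h10
    split_ifs at h10 <;> norm_num at h10
    assumption
  refine ⟨?_, h, hh1, ?_⟩
  · -- otherwise `T` has coefficient two on the right, but `4`, `5`, `0` or `1` on the left
    by_contra hne
    have h10 := congrArg (coeff T) h9
    simp only [map_add, coeff_of, coeff_two_mul, coeff_four_mul, if_true, hh1, if_neg hne,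
      if_neg ht1.symm, if_neg hts.symm] at h10
    split_ifs at h10 <;> norm_num at h10
  · apply eq_act_of_mem hh1
    have h10 : h ∈ T ⋆ z := by
      rw [mul_eq_of_two_mul hTz]
      exact Sym2.mem_mk_left _ _
    have h11 := mem_mul_rotate h10
    rw [hc.out]
    exact h11

/-- Elements of order at most two act freely on each other. -/
theorem eq_one_of_of_mul_of_eq {u x : X} (h : of u * of x = of x) (hx : pow x 2 = one) :
    u = one := by
  apply of_injective
  rw [of_one]
  linear_combination of x * h + (1 - of u) * of_sq_eq_one hx

/-- In the presence of a special pair all squares are `e` or `s`. -/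
theorem pow_two_eq_one_or {s x y z : X} (hs : pow s 2 = one) (hs1 : s ≠ one)
    (hx : pow x 2 = s) (hy : pow y 2 = s) (h : x ⋆ y = s(z, z)) (t : X) :
    pow t 2 = one ∨ pow t 2 = s := by
  by_contra! ⟨ht1, hts⟩
  have hz : pow z 2 = s := by
    rw [← hx]
    exact (pow_two_eq_of_mul_eq h (hx ▸ hs1) (hy ▸ hs1)).2.1
  have hxs := act_eq_self hs hx
  have hys := act_eq_self hs hy
  have hzs := act_eq_self hs hz
  have hxx := two_mul_of_sq x
  have hyy := two_mul_of_sq y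
  rw [hx] at hxx
  rw [hy] at hyy
  have hxy : of x * of y = of z := by
    apply two_mul_cancel
    rw [two_mul_of_mul_of h, two_mul]
  have hxz : of x * of z = of y := by
    apply two_mul_cancel
    linear_combination -2 * of x * hxy + of y * hxx + hys
  have hyz : of y * of z = of x := by
    apply two_mul_cancel
    linear_combination -2 * of y * hxy + of x * hyy + hxs
  obtain ⟨a, ha⟩  := exists_mem_mul t x
  obtain ⟨c, hcy⟩  := exists_mem_mul t y
  obtain ⟨f, hf⟩  := exists_mem_mul t z
  have hat := pow_two_of_mem hs hx ha
  have hct := pow_two_of_mem hs hy hcy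
  have hft := pow_two_of_mem hs hz hf
  have hxy_orbit := pow_two_mem_orbit hs hs1 hx hy hz hxy ht1 hts ha hcy
  have hxz_orbit := pow_two_mem_orbit hs hs1 hx hz hy hxz ht1 hts ha hf
  have hyz_orbit := pow_two_mem_orbit hs hs1 hy hz hx hyz ht1 hts hcy hf
  -- the squares of `a`, `c`, `f` lie in `{t², s t²}`, so two of them agree
  have hst : act s (pow t 2) = pow t 2 := by
    by_cases h1 : pow a 2 = pow c 2
    · exact (hxy_orbit h1).1
    by_cases h2 : pow a 2 = pow f 2
    · exact (hxz_orbit h2).1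
    by_cases h3 : pow c 2 = pow f 2
    · exact (hyz_orbit h3).1
    grind
  rw [hst, or_self] at hat hct hft
  obtain ⟨-, h, hh, h1⟩ := hxy_orbit (hat.trans hct.symm)
  obtain ⟨-, h', hh', h2⟩ := hyz_orbit (hct.trans hft.symm)
  have h3 : of h * of z = of h' * of x := by
    rw [← of_act hh, ← of_act hh', ← h1, ← h2]
  -- multiply `h z = h' x` by `x`
  have h4 : s(act h y, act h y) = s(h', act s h') := by
    apply sym2_eq_of_add_eq
    rw [of_act hh, of_act hs]
    linear_combination 2 * of x * h3 - 2 * of h * hxz + of h' * hxx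
  have h5 : act s h' = h' := by
    rw [Sym2.eq_iff] at h4
    grind
  exact hs1 (eq_one_of_of_mul_of_eq (by rw [← of_act hs, h5]) hh')

end

end TwoValuedGroup

/-! ### Boolean groups -/

theorem IsBooleanGroup.of_mul_self {G : Type*} [CommGroup G] (h : ∀ g : G, g * g = 1) :
    IsBooleanGroup G :=
  ⟨fun g hg => orderOf_eq_prime (by rw [pow_two, h]) hg⟩

theorem IsBooleanGroup.two_le_dim {V : Type*} [CommGroup V] [IsBooleanGroup V] {a b : V}
    (ha : a ≠ 1) (hb : b ≠ 1) (hab : a ≠ b) : 2 ≤ IsBooleanGroup.dim V := by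
  let : Module (ZMod 2) (Additive V) := AddCommGroup.zmodModule fun x => by
    rw [two_nsmul]
    exact IsBooleanGroup.mul_self x.toMul
  change 2 ≤ Module.rank (ZMod 2) (Additive V)
  by_contra! h
  have h1 : Module.rank (ZMod 2) (Additive V) ≤ 1 :=
    Order.lt_succ_iff.1 (by
      rwa [← Nat.cast_one, Cardinal.succ_natCast, Nat.cast_one, one_add_one_eq_two])
  obtain ⟨v, hv⟩ := rank_le_one_iff.1 h1
  have key : ∀ c : V, c ≠ 1 → Additive.ofMul c = v := fun c hc => by
    obtain ⟨r, hr⟩ := hv (Additive.ofMul c)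
    have h01 : ∀ r : ZMod 2, r = 0 ∨ r = 1 := by decide
    rcases h01 r with rfl | rfl
    · rw [zero_smul] at hr
      exact absurd (Additive.ofMul.injective hr.symm) hc
    · rw [← hr, one_smul]
  exact hab (Additive.ofMul.injective ((key a ha).trans (key b hb).symm))

/-- Quotients of Boolean groups split, because subspaces of vector spaces have complements. -/
theorem IsBooleanGroup.exists_section {G : Type*} [CommGroup G] [IsBooleanGroup G]
    (W : Subgroup G) : ∃ σ : G ⧸ W →* G, ∀ v, (σ v : G ⧸ W) = v := by
  let : Module (ZMod 2) (Additive G) := AddCommGroup.zmodModule fun x => by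
    rw [two_nsmul]
    exact IsBooleanGroup.mul_self x.toMul
  let : Module (ZMod 2) (Additive (G ⧸ W)) := AddCommGroup.zmodModule fun x => by
    rw [two_nsmul]
    change x.toMul * x.toMul = 1
    induction x.toMul using QuotientGroup.induction_on with
    | H g => rw [← QuotientGroup.mk_mul, IsBooleanGroup.mul_self, QuotientGroup.mk_one]
  let p := (QuotientGroup.mk' W).toAdditive.toZModLinearMap 2
  obtain ⟨q, hq⟩ := p.exists_rightInverse_of_surjective
    (LinearMap.range_eq_top.2 (QuotientGroup.mk'_surjective W))
  exact ⟨AddMonoidHom.toMultiplicative q.toAddMonoidHom, fun v => LinearMap.congr_fun hq v⟩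

namespace TwoValuedGroup
open Alg

variable {X : Type*} [TwoValuedGroup X]

/-! ### The group of elements of order at most two and the orbits of `s` -/

/-- The elements of order at most two. -/
def Invol (X : Type*) [TwoValuedGroup X] : Type _ := {u : X // pow u 2 = one}

theorem Invol.ext_of {u v : Invol X} (h : of u.1 = of v.1) : u = v := Subtype.ext (of_injective h)

/-- An element of order two such that every square is `e` or `s`. -/
class IsSquareElement (s : X) : Prop where
  pow_two_self : pow s 2 = one
  ne_one : s ≠ one
  pow_two_eq_or : ∀ t : X, pow t 2 = one ∨ pow t 2 = s

theorem IsSquareElement.pow_two_eq {s t : X} [hs : IsSquareElement s] (ht : pow t 2 ≠ one) :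
    pow t 2 = s :=
  (hs.pow_two_eq_or t).resolve_left ht

section

variable [hc : Fact (IsCommutative X)] [hi : Fact (IsInvolutive X)]

theorem one_pow_two : pow (one : X) 2 = one :=
  pow_two_eq_one_of_mul_self (by rw [of_one, _root_.mul_one])

noncomputable instance : CommGroup (Invol X) where
  mul u v := ⟨act u.1 v.1, pow_two_act u.2 v.2⟩
  one := ⟨one, one_pow_two⟩
  inv u := u
  mul_assoc u v w := Invol.ext_of <|
    show of (act (act u.1 v.1) w.1) = of (act u.1 (act v.1 w.1)) by
      rw [of_act (pow_two_act u.2 v.2), of_act u.2, of_act u.2, of_act v.2, _root_.mul_assoc]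
  mul_comm u v := Invol.ext_of <| show of (act u.1 v.1) = of (act v.1 u.1) by
    rw [of_act u.2, of_act v.2, mul_comm]
  one_mul u := Invol.ext_of <| show of (act one u.1) = of u.1 by
    rw [of_act one_pow_two, of_one, _root_.one_mul]
  mul_one u := Invol.ext_of <| show of (act u.1 one) = of u.1 by
    rw [of_act u.2, of_one, _root_.mul_one]
  inv_mul_cancel u := Invol.ext_of <| show of (act u.1 u.1) = of one by
    rw [of_act u.2, of_sq_eq_one u.2, of_one]

theorem Invol.val_mul (u v : Invol X) : (u * v).1 = act u.1 v.1 := rfl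

theorem Invol.val_one : (1 : Invol X).1 = one := rfl

theorem Invol.of_mul (u v : Invol X) : of (u * v).1 = of u.1 * of v.1 := of_act u.2 v.1

instance : IsBooleanGroup (Invol X) := .of_mul_self fun u => inv_mul_cancel u

/-- The idempotent `(e + s) / 2` of the algebra. -/
noncomputable def idem (s : X) : Alg X := (1 / 2 : ℚ) • (1 + of s)

omit hi in
theorem two_mul_idem (s : X) : 2 * idem s = 1 + of s := by
  rw [idem, two_mul, ← two_smul ℚ, smul_smul]
  simp

variable (s : X) [hs : IsSquareElement s]

theorem of_s_mul_idem : of s * idem s = idem s := by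
  apply two_mul_cancel
  linear_combination (of s - 1) * two_mul_idem s + of_sq_eq_one hs.pow_two_self

theorem idem_mul_idem : idem s * idem s = idem s := by
  apply two_mul_cancel
  linear_combination idem s * two_mul_idem s + of_s_mul_idem s

/-- Modulo the action of `s`, all values of a product agree. -/
theorem of_mul_of_mul_idem {x y z : X} (hz : z ∈ x ⋆ y) :
    of x * of y * idem s = of z * idem s := by
  by_cases hy : pow y 2 = one
  · rw [hc.out] at hz
    rw [eq_act_of_mem hy hz, of_act hy]
    ring
  · have h := two_mul_of_mul_of (mul_eq_orbit hs.pow_two_self (hs.pow_two_eq hy) hz)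
    rw [of_act hs.pow_two_self] at h
    apply two_mul_cancel
    linear_combination idem s * h + of z * of_s_mul_idem s

/-- The set of orbits of `s`, on which the multiplication of `X` becomes single-valued. An orbit
`{x, sx}` is encoded as the element `(x + sx) / 2` of the algebra. -/
def Orbits : Type _ := {g : Alg X // ∃ x : X, of x * idem s = g}

/-- The orbit of an element. -/
noncomputable def orbit (x : X) : Orbits s := ⟨of x * idem s, x, rfl⟩

omit hi hs in
theorem orbit_surjective : Function.Surjective (orbit s) := by
  rintro ⟨g, x, rfl⟩
  exact ⟨x, rfl⟩

theorem mul_self_mul_idem (x : X) : of x * of x * idem s = idem s := by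
  have h := of_mul_of_mul_idem s (pow_two_mem x)
  rcases hs.pow_two_eq_or x with h' | h' <;> rw [h, h']
  · rw [of_one, _root_.one_mul]
  · exact of_s_mul_idem s

noncomputable instance : CommGroup (Orbits s) where
  mul g h := ⟨g.1 * h.1, by
    obtain ⟨_, x, rfl⟩ := g
    obtain ⟨_, y, rfl⟩ := h
    obtain ⟨z, hz⟩ := exists_mem_mul x y
    refine ⟨z, ?_⟩
    linear_combination -(of_mul_of_mul_idem s hz) - of x * of y * idem_mul_idem s⟩
  one := ⟨idem s, one, by rw [of_one, _root_.one_mul]⟩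
  inv g := g
  mul_assoc g h k := Subtype.ext (_root_.mul_assoc g.1 h.1 k.1)
  mul_comm g h := Subtype.ext (mul_comm g.1 h.1)
  one_mul g := Subtype.ext <| show idem s * g.1 = g.1 by
    obtain ⟨_, x, rfl⟩ := g
    linear_combination of x * idem_mul_idem s
  mul_one g := Subtype.ext <| show g.1 * idem s = g.1 by
    obtain ⟨_, x, rfl⟩ := g
    linear_combination of x * idem_mul_idem s
  inv_mul_cancel g := Subtype.ext <| show g.1 * g.1 = idem s by
    obtain ⟨_, x, rfl⟩ := g
    linear_combination mul_self_mul_idem s x + of x * of x * idem_mul_idem s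

instance : IsBooleanGroup (Orbits s) := .of_mul_self fun g => inv_mul_cancel g

theorem orbit_mul {x y z : X} (hz : z ∈ x ⋆ y) : orbit s z = orbit s x * orbit s y :=
  Subtype.ext <| show of z * idem s = of x * idem s * (of y * idem s) by
    linear_combination -(of_mul_of_mul_idem s hz) - of x * of y * idem_mul_idem s

theorem orbit_act {u : X} (hu : pow u 2 = one) (x : X) :
    orbit s (act u x) = orbit s u * orbit s x :=
  orbit_mul s (by rw [mul_eq_act hu]; exact Sym2.mem_mk_left _ _)

theorem orbit_eq_iff {x y : X} : orbit s x = orbit s y ↔ x = y ∨ x = act s y := by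
  constructor
  · intro h
    have h' : of x * idem s = of y * idem s := congrArg Subtype.val h
    have h1 : s(x, act s x) = s(y, act s y) := by
      apply sym2_eq_of_add_eq
      rw [of_act hs.pow_two_self, of_act hs.pow_two_self]
      linear_combination 2 * h' - (of x - of y) * two_mul_idem s
    rw [Sym2.eq_iff] at h1
    exact h1.imp And.left And.left
  · rintro (rfl | rfl)
    · rfl
    · refine Subtype.ext (show of (act s y) * idem s = of y * idem s from ?_)
      rw [of_act hs.pow_two_self]
      linear_combination of y * of_s_mul_idem s

theorem act_s_of_ne {t : X} (ht : pow t 2 ≠ one) : act s t = t := by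
  apply of_injective
  rw [of_act hs.pow_two_self, act_eq_self hs.pow_two_self (hs.pow_two_eq ht)]

/-- The homomorphism from the group of elements of order at most two to the group of orbits. -/
noncomputable def involHom : Invol X →* Orbits s where
  toFun u := orbit s u.1
  map_one' := Subtype.ext (by rw [Invol.val_one]; exact _root_.one_mul _)
  map_mul' u v := orbit_act s u.2 v.1

theorem orbit_mem_range {x : X} : orbit s x ∈ (involHom s).range ↔ pow x 2 = one := by
  constructor
  · rintro ⟨u, hu⟩
    rcases (orbit_eq_iff s).1 hu.symm with rfl | rfl
    · exact u.2
    · exact pow_two_act hs.pow_two_self u.2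
  · exact fun h => ⟨⟨x, h⟩, rfl⟩

end

end TwoValuedGroup

/-- The inverse of an isomorphism of topological two-valued groups. -/
def TopTwoValuedIso.symm {X Y : Type*} [TopologicalSpace X] [TwoValuedGroup X]
    [TopologicalSpace Y] [TwoValuedGroup Y] (φ : TopTwoValuedIso X Y) : TopTwoValuedIso Y X where
  toHomeomorph := φ.toHomeomorph.symm
  map_mul x y := by
    have h := φ.map_mul (φ.toHomeomorph.symm x) (φ.toHomeomorph.symm y)
    have hx : φ.toFun (φ.toHomeomorph.symm x) = x := φ.toHomeomorph.apply_symm_apply x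
    have hy : φ.toFun (φ.toHomeomorph.symm y) = y := φ.toHomeomorph.apply_symm_apply y
    rw [hx, hy] at h
    rw [h, Sym2.map_map]
    have h1 : φ.toHomeomorph.symm ∘ φ.toFun = id := funext φ.toHomeomorph.symm_apply_apply
    exact (congrFun (congrArg Sym2.map h1) _).trans (congrFun Sym2.map_id _) |>.symm
  map_one := φ.toHomeomorph.symm_apply_eq.2 φ.map_one.symm
  map_inv x := by
    refine φ.toHomeomorph.symm_apply_eq.2 ?_
    refine Eq.trans ?_ (φ.map_inv _).symm
    exact congrArg TwoValuedGroup.inv (φ.toHomeomorph.apply_symm_apply x).symm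

namespace TwoValuedGroup
open Alg SpecialY

variable {X : Type*} [TwoValuedGroup X]

/-! ### The algebraic isomorphism -/

section

variable [hc : Fact (IsCommutative X)] [hi : Fact (IsInvolutive X)]
variable (s : X) [hs : IsSquareElement s]

/-- The element `s` in the group of elements of order at most two. -/
def involS : Invol X := ⟨s, hs.pow_two_self⟩

/-- The quotient of the group of orbits of `s` by the image of the elements of order at most two,
that is, the set of orbits of `Invol X` on `X`. It serves as `V`. -/
abbrev OrbitQuot : Type _ := Orbits s ⧸ (involHom s).range

instance : IsBooleanGroup (OrbitQuot s) := .of_mul_self fun g => by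
  induction g using QuotientGroup.induction_on with
  | H g => rw [← QuotientGroup.mk_mul, IsBooleanGroup.mul_self, QuotientGroup.mk_one]

/-- A splitting of the projection onto `OrbitQuot s`. -/
noncomputable def splitting : OrbitQuot s →* Orbits s :=
  (IsBooleanGroup.exists_section (involHom s).range).choose

theorem mk_splitting (v : OrbitQuot s) : (splitting s v : OrbitQuot s) = v :=
  (IsBooleanGroup.exists_section (involHom s).range).choose_spec v

/-- Representatives in `X`, multiplicative up to the action of `s`. -/
noncomputable def rep (v : OrbitQuot s) : X := (orbit_surjective s (splitting s v)).choose

theorem orbit_rep (v : OrbitQuot s) : orbit s (rep s v) = splitting s v :=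
  (orbit_surjective s (splitting s v)).choose_spec

theorem mk_orbit_act_rep (u : Invol X) (v : OrbitQuot s) :
    (orbit s (act u.1 (rep s v)) : OrbitQuot s) = v := by
  rw [orbit_act s u.2, orbit_rep, QuotientGroup.mk_mul, mk_splitting,
    (QuotientGroup.eq_one_iff _).2 ((orbit_mem_range s).2 u.2), _root_.one_mul]

theorem pow_two_act_rep (u : Invol X) (v : {v : OrbitQuot s // v ≠ 1}) :
    pow (act u.1 (rep s v)) 2 ≠ one := fun h => v.2 <| by
  rw [← mk_orbit_act_rep s u v]
  exact (QuotientGroup.eq_one_iff _).2 ((orbit_mem_range s).2 h)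

theorem eq_of_orbit_eq {x y : X} (hy : pow y 2 ≠ one) (h : orbit s x = orbit s y) : x = y := by
  rcases (orbit_eq_iff s).1 h with h | h
  · exact h
  · rw [h, act_s_of_ne s hy]

theorem orbit_involS_mul (u : Invol X) : orbit s (involS s * u).1 = orbit s u.1 :=
  (orbit_eq_iff s).2 (Or.inr rfl)

theorem mk_eq_iff (u u' : Invol X) :
    (u : Invol X ⧸ Subgroup.zpowers (involS s)) = u' ↔ orbit s u.1 = orbit s u'.1 := by
  constructor
  · intro h
    have h1 := congrArg fiber h
    rw [fiber_mk, fiber_mk, Sym2.eq_iff] at h1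
    rcases h1 with h1 | h1
    · rw [h1.1]
    · rw [h1.1, orbit_involS_mul]
  · intro h
    rcases (orbit_eq_iff s).1 h with h | h
    · rw [Subtype.ext h]
    · rw [show u = involS s * u' from Subtype.ext h, mk_s_mul]

/-- The map `W → X`, `π(u) ↦ u * x`, for `x` of order greater than two. -/
noncomputable def orbitMap (x : {x : X // pow x 2 ≠ one}) :
    Invol X ⧸ Subgroup.zpowers (involS s) → X :=
  Quotient.lift (fun u : Invol X => act u.1 x.1) fun u u' h => by
    have h1 := (mk_eq_iff s u u').1 (Quotient.sound h)
    have h2 : pow (act u'.1 x.1) 2 ≠ one := fun h3 => x.2 <| by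
      rw [← act_act u'.2 x.1]
      exact pow_two_act u'.2 h3
    apply eq_of_orbit_eq s h2
    rw [orbit_act s u.2, orbit_act s u'.2, h1]

/-- The representative `rep s v`, with a proof that its order is greater than two. -/
noncomputable def repOfNeOne (v : {v : OrbitQuot s // v ≠ 1}) : {x : X // pow x 2 ≠ one} :=
  ⟨rep s v, fun h => pow_two_act_rep s 1 v (pow_two_act (1 : Invol X).2 h)⟩

/-- The map `Y → X` that is the inclusion on `U` and sends `(v, π(u))` to `u * rep v`. -/
noncomputable def fromY : SpecialY (OrbitQuot s) (Invol X) (involS s) → X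
  | .inl u => u.1
  | .inr (v, w) => orbitMap s (repOfNeOne s v) w

theorem fromY_ofU (u : Invol X) : fromY s (ofU u) = u.1 := rfl

theorem fromY_ofVW (v : {v : OrbitQuot s // v ≠ 1}) (u : Invol X) :
    fromY s (ofVW v u) = act u.1 (rep s v) := rfl

theorem fromY_injective : Function.Injective (fromY s) := by
  intro x y h
  induction x using ind with
  | h₁ a =>
    induction y using ind with
    | h₁ b => rw [Subtype.ext h]
    | h₂ w b => exact absurd ((congrArg (pow · 2) h).symm.trans a.2) (pow_two_act_rep s b w)
  | h₂ v a =>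
    induction y using ind with
    | h₁ b => exact absurd ((congrArg (pow · 2) h).trans b.2) (pow_two_act_rep s a v)
    | h₂ w b =>
      rw [fromY_ofVW, fromY_ofVW] at h
      have h1 := congrArg (fun x => (orbit s x : OrbitQuot s)) h
      simp only [mk_orbit_act_rep] at h1
      obtain rfl := Subtype.ext h1
      have h2 := congrArg (orbit s) h
      rw [orbit_act s a.2, orbit_act s b.2, mul_left_inj, ← mk_eq_iff] at h2
      rw [h2]

theorem fromY_surjective : Function.Surjective (fromY s) := by
  intro x
  by_cases hx : pow x 2 = one
  · exact ⟨ofU ⟨x, hx⟩, rfl⟩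
  · have hv : (orbit s x : OrbitQuot s) ≠ 1 := fun h =>
      hx ((orbit_mem_range s).1 ((QuotientGroup.eq_one_iff _).1 h))
    obtain ⟨u, hu⟩ := QuotientGroup.eq.1 (mk_splitting s (orbit s x))
    refine ⟨ofVW ⟨_, hv⟩ u, ?_⟩
    rw [fromY_ofVW]
    apply eq_of_orbit_eq s hx
    rw [orbit_act s u.2, orbit_rep]
    change involHom s u * _ = _
    rw [hu, mul_comm, mul_inv_cancel_left]

theorem fromY_map_mul (x y : SpecialY (OrbitQuot s) (Invol X) (involS s)) :
    fromY s x ⋆ fromY s y = (SpecialY.mul x y).map (fromY s) := by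
  have hUV : ∀ (a : Invol X) (v : {v : OrbitQuot s // v ≠ 1}) (b : Invol X),
      fromY s (ofU a) ⋆ fromY s (ofVW v b) =
        s(fromY s (ofVW v (a * b : Invol X)), fromY s (ofVW v (a * b : Invol X))) := by
    intro a v b
    rw [fromY_ofU, fromY_ofVW, fromY_ofVW, mul_eq_act a.2, of_injective (a₁ := act a.1 _)]
    rw [of_act a.2, of_act b.2, of_act (a * b).2, Invol.of_mul, _root_.mul_assoc]
  induction x using ind with
  | h₁ a =>
    induction y using ind with
    | h₁ b => exact mul_eq_act a.2 b.1
    | h₂ w b => exact hUV a w b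
  | h₂ v a =>
    induction y using ind with
    | h₁ b =>
      rw [hc.out]
      exact hUV b v a
    | h₂ w b =>
      by_cases e : v = w
      · subst e
        rw [mul_ofVW_self, ← QuotientGroup.mk_mul, fiber_mk, Sym2.map_mk, Sym2.map_mk,
          fromY_ofVW, fromY_ofVW, fromY_ofU, fromY_ofU]
        apply mul_eq_of_two_mul
        rw [Invol.of_mul, Invol.of_mul, of_act a.2, of_act b.2]
        have h := two_mul_of_sq (rep s v)
        rw [show pow (rep s v) 2 = s from hs.pow_two_eq (repOfNeOne s v).2] at h
        rw [show of (involS s).1 = of s from rfl, Invol.of_mul]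
        linear_combination of a.1 * of b.1 * h
      · rw [mul_ofVW_ofVW e, ← QuotientGroup.mk_mul, Sym2.map_mk, fromY_ofVW, fromY_ofVW,
          fromY_ofVW]
        obtain ⟨z, hz⟩ := exists_mem_mul (act a.1 (rep s v)) (act b.1 (rep s w))
        have hzo : z = act (a * b).1 (rep s (v * w)) := by
          apply eq_of_orbit_eq s
            (pow_two_act_rep s (a * b) ⟨v * w, mul_ne_one_of_ne fun h => e (Subtype.ext h)⟩)
          rw [orbit_mul s hz, orbit_act s a.2, orbit_act s b.2, orbit_act s (a * b).2,
            Invol.val_mul, orbit_act s a.2, orbit_rep, orbit_rep, orbit_rep, map_mul]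
          exact mul_mul_mul_comm _ _ _ _
        rw [mul_eq_orbit hs.pow_two_self (hs.pow_two_eq (pow_two_act_rep s b w)) hz, hzo,
          act_s_of_ne s (pow_two_act_rep s (a * b)
            ⟨v * w, mul_ne_one_of_ne fun h => e (Subtype.ext h)⟩)]

end

/-! ### The topology -/

section

variable [TopologicalSpace X] [ht : IsTopologicalTwoValuedGroup X]

/-- Continuity of the multiplication, tested on the open sets of `Sym2 X` given by an open set
of `X`. -/
theorem isOpen_forall_mem_mul {O : Set X} (hO : IsOpen O) :
    IsOpen {p : X × X | ∀ z ∈ p.1 ⋆ p.2, z ∈ O} := by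
  have h : IsOpen {m : Sym2 X | ∀ z ∈ m, z ∈ O} := by
    refine isQuotientMap_quot_mk.isOpen_preimage.1 ?_
    have : (Quot.mk _ : X × X → Sym2 X) ⁻¹' {m : Sym2 X | ∀ z ∈ m, z ∈ O} = O ×ˢ O := by
      ext ⟨a, b⟩
      exact Sym2.ball
    rw [this]
    exact hO.prod hO
  exact h.preimage ht.continuous_mul

theorem isOpen_exists_mem_mul {O : Set X} (hO : IsOpen O) :
    IsOpen {p : X × X | ∃ z ∈ p.1 ⋆ p.2, z ∈ O} := by
  have h : IsOpen {m : Sym2 X | ∃ z ∈ m, z ∈ O} := by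
    refine isQuotientMap_quot_mk.isOpen_preimage.1 ?_
    have : (Quot.mk _ : X × X → Sym2 X) ⁻¹' {m : Sym2 X | ∃ z ∈ m, z ∈ O} =
        Prod.fst ⁻¹' O ∪ Prod.snd ⁻¹' O := by
      ext ⟨a, b⟩
      change (∃ z ∈ s(a, b), z ∈ O) ↔ a ∈ O ∨ b ∈ O
      simp
    rw [this]
    exact (hO.preimage continuous_fst).union (hO.preimage continuous_snd)
  exact h.preimage ht.continuous_mul

variable [hc : Fact (IsCommutative X)] [hi : Fact (IsInvolutive X)]

instance : TopologicalSpace (Invol X) := inferInstanceAs (TopologicalSpace {u : X // pow u 2 = one})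

instance [T2Space X] : T2Space (Invol X) := inferInstanceAs (T2Space {u : X // pow u 2 = one})

theorem continuous_act {Z : Type*} [TopologicalSpace Z] {f : Z → Invol X} {g : Z → X}
    (hf : Continuous fun z => (f z).1) (hg : Continuous g) :
    Continuous fun z => act (f z).1 (g z) := by
  refine continuous_def.2 fun O hO => ?_
  convert (isOpen_forall_mem_mul hO).preimage (hf.prodMk hg) using 1
  ext z
  simp [mul_eq_act (f z).2]

instance : IsTopologicalGroup (Invol X) where
  continuous_mul := Continuous.subtype_mk
    (continuous_act (continuous_subtype_val.comp continuous_fst)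
      (continuous_subtype_val.comp continuous_snd)) _
  continuous_inv := continuous_id

/-- The only possible squares are `e` and `s`, which can be separated. -/
theorem isClopen_pow_two_eq_one (s : X) [hs : IsSquareElement s] [T1Space X] :
    IsClopen {x : X | pow x 2 = one} := by
  have hdiag : Continuous fun x : X => (x, x) := continuous_id.prodMk continuous_id
  constructor
  · refine ⟨?_⟩
    convert (isOpen_exists_mem_mul (isOpen_compl_singleton (x := (one : X)))).preimage hdiag using 1
    ext x
    simp [mul_self_eq]
  · convert (isOpen_forall_mem_mul (isOpen_compl_singleton (x := s))).preimage hdiag using 1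
    ext x
    have h := hs.pow_two_eq_or x
    have h1 := hs.ne_one
    simp only [Set.mem_ofPred_eq, Set.mem_preimage, mul_self_eq, Sym2.ball, Set.mem_compl_iff,
      Set.mem_singleton_iff]
    grind

variable (s : X) [hs : IsSquareElement s]

theorem fromY_continuous : Continuous (fromY s) := by
  let : TopologicalSpace (OrbitQuot s) := ⊥
  have : DiscreteTopology (OrbitQuot s) := ⟨rfl⟩
  refine continuous_sum_dom.2 ⟨continuous_subtype_val, ?_⟩
  refine continuous_prod_of_discrete_left.2 fun v => ?_
  exact isQuotientMap_quot_mk.continuous_iff.2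
    (continuous_act continuous_subtype_val continuous_const)

theorem fromY_isOpenMap [T1Space X] : IsOpenMap (fromY s) := by
  let : TopologicalSpace (OrbitQuot s) := ⊥
  have : DiscreteTopology (OrbitQuot s) := ⟨rfl⟩
  have hB : IsOpenMap (Subtype.val : Invol X → X) :=
    (isClopen_pow_two_eq_one s).isOpen.isOpenMap_subtype_val
  refine isOpenMap_sum.2 ⟨hB, ?_⟩
  have hW : ∀ v, IsOpenMap (orbitMap s (repOfNeOne s v)) := by
    intro v S hS
    -- `y` lies in the image iff both values of `rep v ⋆ y` lie in `U` and
    -- represent points of `S`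
    have hO := hB _ (hS.preimage continuous_quot_mk)
    convert (isOpen_forall_mem_mul hO).preimage
      (continuous_const (y := rep s v) |>.prodMk continuous_id) using 1
    ext y
    have hx2 : pow (rep s v) 2 = s := hs.pow_two_eq (repOfNeOne s v).2
    constructor
    · rintro ⟨w, hw, rfl⟩ z hz
      induction w using QuotientGroup.induction_on with
      | H u =>
        have h1 : rep s v ⋆ act u.1 (rep s v) = s(u.1, (involS s * u).1) := by
          apply mul_eq_of_two_mul
          have h2 := two_mul_of_sq (rep s v)
          rw [hx2] at h2
          rw [of_act u.2, Invol.of_mul, show of (involS s).1 = of s from rfl]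
          linear_combination of u.1 * h2
        have h3 : z ∈ s(u.1, (involS s * u).1) := h1 ▸ hz
        rcases Sym2.mem_iff.1 h3 with rfl | rfl
        · exact ⟨u, hw, rfl⟩
        · refine ⟨involS s * u, ?_, rfl⟩
          change ((involS s * u : Invol X) : Invol X ⧸ Subgroup.zpowers (involS s)) ∈ S
          rwa [mk_s_mul]
    · intro h
      obtain ⟨z, hz⟩ := exists_mem_mul (rep s v) y
      obtain ⟨u, hu, rfl⟩ := h z hz
      refine ⟨QuotientGroup.mk u, hu, ?_⟩
      have h1 : y ∈ u.1 ⋆ rep s v := mem_mul_rotate (mem_mul_rotate hz)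
      exact (eq_act_of_mem u.2 h1).symm
  intro S hS
  have h : (fun p => fromY s (Sum.inr p)) '' S =
      ⋃ v, orbitMap s (repOfNeOne s v) '' (Prod.mk v ⁻¹' S) := by
    ext y
    simp [fromY]
  rw [h]
  exact isOpen_iUnion fun v => hW v _ (hS.preimage (Continuous.prodMk_right v))

/-- The isomorphism of topological two-valued groups between the model and `X`. -/
noncomputable def fromYIso [T1Space X] :
    TopTwoValuedIso (SpecialY (OrbitQuot s) (Invol X) (involS s)) X where
  toHomeomorph := (Equiv.ofBijective (fromY s)
    ⟨fromY_injective s, fromY_surjective s⟩).toHomeomorphOfContinuousOpen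
      (fromY_continuous s) (fromY_isOpenMap s)
  map_mul := fromY_map_mul s
  map_one := rfl
  map_inv _ := (hi.out _).symm

end

/-! ### Special two-valued groups are models -/

section

theorem pow_two_ne_one_of_two_lt_ord {x : X} (h : 2 < ord x) : pow x 2 ≠ one := fun h' =>
  absurd (iInf₂_le (f := fun (k : ℕ) (_ : 0 < k ∧ pow x k = one) => (k : ℕ∞)) 2 ⟨two_pos, h'⟩)
    (not_le.2 h)

variable [hc : Fact (IsCommutative X)] [hi : Fact (IsInvolutive X)]

theorem IsSpecialPair.isSquareElement {x y : X} (h : IsSpecialPair x y) :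
    IsSquareElement (pow x 2) := by
  obtain ⟨hx, hy, z, hz⟩ := h
  replace hx := pow_two_ne_one_of_two_lt_ord hx
  replace hy := pow_two_ne_one_of_two_lt_ord hy
  obtain ⟨h1, -, h2⟩ := pow_two_eq_of_mul_eq hz hx hy
  exact ⟨h2, hx, pow_two_eq_one_or h2 hx rfl h1 hz⟩

/-- The two members of a special pair have different non-trivial classes in `V`: if they had the
same class, their product would contain an element of order at most two. -/
theorem IsSpecialPair.two_le_dim {x y : X} (h : IsSpecialPair x y) (s : X) [IsSquareElement s] :
    2 ≤ IsBooleanGroup.dim (OrbitQuot s) := by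
  obtain ⟨hx, hy, z, hz⟩ := h
  replace hx := pow_two_ne_one_of_two_lt_ord hx
  replace hy := pow_two_ne_one_of_two_lt_ord hy
  have hz1 := (pow_two_eq_of_mul_eq hz hx hy).2.1
  have key : ∀ t : X, (orbit s t : OrbitQuot s) = 1 ↔ pow t 2 = one := fun t =>
    (QuotientGroup.eq_one_iff _).trans (orbit_mem_range s)
  refine IsBooleanGroup.two_le_dim (mt (key x).1 hx) (mt (key y).1 hy) fun h => hx ?_
  rw [← hz1, ← key, orbit_mul s (hz ▸ Sym2.mem_mk_left z z), QuotientGroup.mk_mul, h,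
    IsBooleanGroup.mul_self]

end

end TwoValuedGroup

theorem exists_specialY_iso.{w} (X : Type w) [TopologicalSpace X] [T2Space X] [TwoValuedGroup X]
    [IsTopologicalTwoValuedGroup X] (hi : TwoValuedGroup.IsInvolutive X)
    (hc : TwoValuedGroup.IsCommutative X) (hs : TwoValuedGroup.IsSpecial X) :
    ∃ (V U : Type w) (_ : CommGroup V) (_ : IsBooleanGroup V)
      (_ : CommGroup U) (_ : IsBooleanGroup U) (_ : TopologicalSpace U)
      (_ : IsTopologicalGroup U) (_ : T2Space U) (s : U),
      2 ≤ IsBooleanGroup.dim V ∧ s ≠ 1 ∧ Nonempty (TopTwoValuedIso X (SpecialY V U s)) := by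
  have : Fact (TwoValuedGroup.IsInvolutive X) := ⟨hi⟩
  have : Fact (TwoValuedGroup.IsCommutative X) := ⟨hc⟩
  obtain ⟨x, y, h⟩ := hs
  have hs := h.isSquareElement
  exact ⟨TwoValuedGroup.OrbitQuot (TwoValuedGroup.pow x 2), TwoValuedGroup.Invol X,
    inferInstance, inferInstance, inferInstance, inferInstance, inferInstance, inferInstance,
    inferInstance, TwoValuedGroup.involS (TwoValuedGroup.pow x 2), h.two_le_dim _,
    fun h => hs.ne_one (congrArg Subtype.val h), ⟨(TwoValuedGroup.fromYIso _).symm⟩⟩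

/-! ### Isomorphisms between the models -/

theorem IsBooleanGroup.exists_ne_one_of_two_le_dim {V : Type*} [CommGroup V] [IsBooleanGroup V]
    (h : 2 ≤ IsBooleanGroup.dim V) : ∃ v : V, v ≠ 1 := by
  let : Module (ZMod 2) (Additive V) := AddCommGroup.zmodModule fun x => by
    rw [two_nsmul]
    exact IsBooleanGroup.mul_self x.toMul
  change 2 ≤ Module.rank (ZMod 2) (Additive V) at h
  have : Nontrivial (Additive V) := rank_pos_iff_nontrivial.1 (two_pos.trans_le h)
  exact exists_ne (0 : Additive V)

theorem TopTwoValuedIso.mem_mul {X Y : Type*} [TopologicalSpace X] [TwoValuedGroup X]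
    [TopologicalSpace Y] [TwoValuedGroup Y] (φ : TopTwoValuedIso X Y) {x y z : X}
    (h : z ∈ TwoValuedGroup.mul x y) :
    φ.toFun z ∈ TwoValuedGroup.mul (φ.toFun x) (φ.toFun y) := by
  rw [φ.map_mul]
  exact Sym2.mem_map.2 ⟨z, h, rfl⟩

theorem TopTwoValuedIso.mul_self_eq_iff {X Y : Type*} [TopologicalSpace X] [TwoValuedGroup X]
    [TopologicalSpace Y] [TwoValuedGroup Y] (φ : TopTwoValuedIso X Y) (x : X) :
    TwoValuedGroup.mul (φ.toFun x) (φ.toFun x) = s(TwoValuedGroup.one, TwoValuedGroup.one) ↔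
      TwoValuedGroup.mul x x = s(TwoValuedGroup.one, TwoValuedGroup.one) := by
  rw [φ.map_mul, ← (Sym2.map.injective φ.toEquiv.injective).eq_iff, Sym2.map_mk]
  change _ ↔ _ = s(φ.toFun _, φ.toFun _)
  rw [φ.map_one]
  rfl

namespace SpecialY
open TwoValuedGroup

section

variable {V U : Type*} [CommGroup V] [CommGroup U] {s : U}

/-- The projection `Y → V`. -/
def proj : SpecialY V U s → V
  | .inl _ => 1
  | .inr (v, _) => v

theorem proj_ofU (u : U) : proj (ofU u : SpecialY V U s) = 1 := rfl

theorem proj_ofVW (v : {v : V // v ≠ 1}) (w : U ⧸ Subgroup.zpowers s) :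
    proj (ofVW v w : SpecialY V U s) = v := rfl

theorem proj_surjective : Function.Surjective (proj : SpecialY V U s → V) := by
  intro v
  by_cases h : v = 1
  · exact ⟨ofU 1, h.symm⟩
  · exact ⟨ofVW ⟨v, h⟩ 1, rfl⟩

theorem exists_ofVW_of_proj_ne_one {x : SpecialY V U s} (h : proj x ≠ 1) :
    ∃ v w, ofVW v w = x := by
  rcases x with a | ⟨v, w⟩
  · exact absurd rfl h
  · exact ⟨v, w, rfl⟩

theorem isInducing_ofU [TopologicalSpace U] :
    Topology.IsInducing (ofU : U → SpecialY V U s) :=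
  letI : TopologicalSpace V := ⊥
  (Topology.IsOpenEmbedding.inl (Y := {v : V // v ≠ 1} × (U ⧸ Subgroup.zpowers s))).isInducing

variable [IsBooleanGroup V] [IsBooleanGroup U]

theorem mul_eq_mul (x y : SpecialY V U s) : x ⋆ y = mul x y := rfl

theorem one_eq : (one : SpecialY V U s) = ofU 1 := rfl

theorem proj_mul {x y z : SpecialY V U s} (h : z ∈ x ⋆ y) : proj z = proj x * proj y := by
  rw [mul_eq_mul] at h
  induction x using ind with
  | h₁ a =>
    induction y using ind with
    | h₁ b =>
      rw [mul_ofU_ofU, Sym2.mem_iff, or_self] at h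
      rw [h, proj_ofU, proj_ofU, proj_ofU, _root_.one_mul]
    | h₂ w b =>
      rw [mul_ofU_ofVW, Sym2.mem_iff, or_self] at h
      rw [h, proj_ofU, proj_ofVW, proj_ofVW, _root_.one_mul]
  | h₂ v a =>
    induction y using ind with
    | h₁ b =>
      rw [mul_ofVW_ofU, Sym2.mem_iff, or_self] at h
      rw [h, proj_ofU, proj_ofVW, proj_ofVW, _root_.mul_one]
    | h₂ w b =>
      by_cases e : v = w
      · subst e
        rw [mul_ofVW_self, Sym2.mem_map] at h
        obtain ⟨u, -, rfl⟩ := h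
        rw [proj_ofU, proj_ofVW, proj_ofVW, IsBooleanGroup.mul_self]
      · rw [mul_ofVW_ofVW e, Sym2.mem_iff, or_self] at h
        rw [h, proj_ofVW, proj_ofVW, proj_ofVW]

theorem ofVW_mul_self (v : {v : V // v ≠ 1}) (w : U ⧸ Subgroup.zpowers s) :
    (ofVW v w : SpecialY V U s) ⋆ ofVW v w = s(one, ofU s) := by
  induction w using QuotientGroup.induction_on with
  | H u =>
    rw [mul_eq_mul, mul_ofVW_self, ← QuotientGroup.mk_mul, IsBooleanGroup.mul_self, fiber_mk,
      _root_.mul_one, one_eq, Sym2.map_mk]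

/-- A characterization of `U` in terms of the two-valued group alone. -/
theorem proj_eq_one_iff (hs : s ≠ 1) {x : SpecialY V U s} :
    proj x = 1 ↔ x ⋆ x = s(one, one) := by
  induction x using ind with
  | h₁ a => simp [proj_ofU, mul_eq_mul, mul_ofU_ofU, IsBooleanGroup.mul_self, one_eq]
  | h₂ v a =>
    rw [ofVW_mul_self, proj_ofVW, one_eq, Sym2.eq_iff, ofU_inj, ofU_inj]
    simp [hs, v.2]

theorem exists_ofU_of_proj_eq_one {x : SpecialY V U s} (h : proj x = 1) : ∃ u, ofU u = x := by
  induction x using ind with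
  | h₁ a => exact ⟨a, rfl⟩
  | h₂ v a => exact absurd h v.2

end

section

variable {V₁ U₁ V₂ U₂ : Type*} [CommGroup V₁] [CommGroup U₁] [CommGroup V₂] [CommGroup U₂]
  [IsBooleanGroup V₁] [IsBooleanGroup U₁] [IsBooleanGroup V₂] [IsBooleanGroup U₂]
  [TopologicalSpace U₁] [TopologicalSpace U₂] {s₁ : U₁} {s₂ : U₂}

theorem proj_iso_eq_one_iff (hs₁ : s₁ ≠ 1) (hs₂ : s₂ ≠ 1)
    (φ : TopTwoValuedIso (SpecialY V₁ U₁ s₁) (SpecialY V₂ U₂ s₂)) (x : SpecialY V₁ U₁ s₁) :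
    proj (φ.toFun x) = 1 ↔ proj x = 1 := by
  rw [proj_eq_one_iff hs₁, proj_eq_one_iff hs₂, φ.mul_self_eq_iff]

theorem exists_monoidHom_of_iso (hs₁ : s₁ ≠ 1) (hs₂ : s₂ ≠ 1)
    (φ : TopTwoValuedIso (SpecialY V₁ U₁ s₁) (SpecialY V₂ U₂ s₂)) :
    ∃ f : U₁ →* U₂, Continuous f ∧ ∀ u, ofU (f u) = φ.toFun (ofU u) := by
  have h : ∀ u, ∃ u', ofU u' = φ.toFun (ofU u) := fun u =>
    exists_ofU_of_proj_eq_one ((proj_iso_eq_one_iff hs₁ hs₂ φ _).2 (proj_ofU u))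
  choose f hf using h
  refine ⟨.mk' f fun a b => ?_, ?_, hf⟩
  · have h := φ.mem_mul (z := ofU (a * b)) (x := ofU a) (y := ofU b)
      (by rw [mul_eq_mul, mul_ofU_ofU]; exact Sym2.mem_mk_left _ _)
    rw [← hf, ← hf, ← hf, mul_eq_mul, mul_ofU_ofU, Sym2.mem_iff, or_self, ofU_inj] at h
    exact h
  · refine (isInducing_ofU (V := V₂) (s := s₂)).continuous_iff.2 ?_
    have h : (ofU : U₂ → SpecialY V₂ U₂ s₂) ∘ f = φ.toFun ∘ ofU := funext hf
    exact (congrArg Continuous h).mpr (φ.continuous_toFun.comp continuous_ofU)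

theorem exists_continuousMulEquiv_of_iso (hs₁ : s₁ ≠ 1) (hs₂ : s₂ ≠ 1) (hV : ∃ v : V₁, v ≠ 1)
    (φ : TopTwoValuedIso (SpecialY V₁ U₁ s₁) (SpecialY V₂ U₂ s₂)) :
    ∃ f : U₁ ≃ₜ* U₂, f s₁ = s₂ := by
  obtain ⟨f, hfc, hf⟩ := exists_monoidHom_of_iso hs₁ hs₂ φ
  obtain ⟨g, hgc, hg⟩ := exists_monoidHom_of_iso hs₂ hs₁ φ.symm
  refine ⟨{ toFun := f, invFun := g, left_inv := fun u => ?_, right_inv := fun u => ?_,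
            map_mul' := map_mul f, continuous_toFun := hfc, continuous_invFun := hgc }, ?_⟩
  · apply (ofU_inj (V := V₁) (s := s₁)).1
    rw [hg, hf]
    exact φ.left_inv _
  · apply (ofU_inj (V := V₂) (s := s₂)).1
    rw [hf, hg]
    exact φ.right_inv _
  · change f s₁ = s₂
    obtain ⟨v, hv⟩ := hV
    -- `s` is the non-trivial square of any element outside `U`
    have h1 := φ.map_mul (ofVW ⟨v, hv⟩ 1) (ofVW ⟨v, hv⟩ 1)
    obtain ⟨v', w', h2⟩ := exists_ofVW_of_proj_ne_one
      (mt (proj_iso_eq_one_iff hs₁ hs₂ φ (ofVW ⟨v, hv⟩ 1)).1 hv)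
    rw [← h2, ofVW_mul_self, ofVW_mul_self, Sym2.map_mk, φ.map_one, ← hf, Sym2.congr_right,
      ofU_inj] at h1
    exact h1.symm

/-- Two elements have the same projection exactly if their product meets `U`, a condition
preserved by isomorphisms. -/
theorem proj_iso_eq (hs₁ : s₁ ≠ 1) (hs₂ : s₂ ≠ 1)
    (φ : TopTwoValuedIso (SpecialY V₁ U₁ s₁) (SpecialY V₂ U₂ s₂)) {x y : SpecialY V₁ U₁ s₁}
    (h : proj x = proj y) : proj (φ.toFun x) = proj (φ.toFun y) := by
  obtain ⟨z, hz⟩ := exists_mem_mul x y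
  have h1 := proj_mul (φ.mem_mul hz)
  rw [(proj_iso_eq_one_iff hs₁ hs₂ φ z).2 (by rw [proj_mul hz, h, IsBooleanGroup.mul_self])] at h1
  by_contra hne
  exact mul_ne_one_of_ne hne h1.symm

theorem nonempty_mulEquiv_of_iso (hs₁ : s₁ ≠ 1) (hs₂ : s₂ ≠ 1)
    (φ : TopTwoValuedIso (SpecialY V₁ U₁ s₁) (SpecialY V₂ U₂ s₂)) : Nonempty (V₁ ≃* V₂) := by
  obtain ⟨σ, hσ⟩ := (proj_surjective (V := V₁) (s := s₁)).hasRightInverse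
  let g : V₁ →* V₂ := .mk' (fun v => proj (φ.toFun (σ v))) fun v w => by
    obtain ⟨z, hz⟩ := exists_mem_mul (σ v) (σ w)
    rw [← proj_mul (φ.mem_mul hz)]
    apply proj_iso_eq hs₁ hs₂
    rw [hσ, proj_mul hz, hσ, hσ]
  refine ⟨MulEquiv.ofBijective g ⟨(injective_iff_map_eq_one g).2 fun v hv => ?_, fun v => ?_⟩⟩
  · rw [← hσ v]
    exact (proj_iso_eq_one_iff hs₁ hs₂ φ _).1 hv
  · obtain ⟨y, rfl⟩ := proj_surjective (s := s₂) v
    refine ⟨proj (φ.invFun y), (proj_iso_eq hs₁ hs₂ φ (hσ _)).trans ?_⟩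
    exact congrArg proj (φ.right_inv y)

end

section

variable {V₁ U₁ V₂ U₂ : Type*} [CommGroup V₁] [CommGroup U₁] [CommGroup V₂] [CommGroup U₂]
  {s₁ : U₁} {s₂ : U₂}

/-- The map `U₁ / ⟨s₁⟩ → U₂ / ⟨s₂⟩` induced by a homomorphism that takes `s₁` to `s₂`. -/
def quotMap (f : U₁ →* U₂) (hf : f s₁ = s₂) :
    U₁ ⧸ Subgroup.zpowers s₁ →* U₂ ⧸ Subgroup.zpowers s₂ :=
  QuotientGroup.map _ _ f <| by
    rw [Subgroup.zpowers_le, Subgroup.mem_comap, hf]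
    exact Subgroup.mem_zpowers s₂

/-- The map of models induced by an isomorphism of the discrete parts and a homomorphism of the
topological parts. -/
def map (g : V₁ ≃* V₂) (f : U₁ →* U₂) (hf : f s₁ = s₂) :
    SpecialY V₁ U₁ s₁ → SpecialY V₂ U₂ s₂ :=
  Sum.map f (Prod.map (fun v => ⟨g v, (map_ne_one_iff g g.injective).2 v.2⟩) (quotMap f hf))

theorem map_ofU (g : V₁ ≃* V₂) (f : U₁ →* U₂) (hf : f s₁ = s₂) (u : U₁) :
    map g f hf (ofU u) = ofU (f u) := rfl

theorem map_ofVW (g : V₁ ≃* V₂) (f : U₁ →* U₂) (hf : f s₁ = s₂) (v : {v : V₁ // v ≠ 1})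
    (w : U₁ ⧸ Subgroup.zpowers s₁) :
    map g f hf (ofVW v w) =
      ofVW ⟨g v, (map_ne_one_iff g g.injective).2 v.2⟩ (quotMap f hf w) := rfl

theorem quotMap_mk (f : U₁ →* U₂) (hf : f s₁ = s₂) (u : U₁) : quotMap f hf u = f u := rfl

theorem continuous_map [TopologicalSpace U₁] [TopologicalSpace U₂] (g : V₁ ≃* V₂)
    (f : U₁ →* U₂) (hf : f s₁ = s₂) (hfc : Continuous f) :
    Continuous (map g f hf) := by
  let : TopologicalSpace V₁ := ⊥
  let : TopologicalSpace V₂ := ⊥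
  have : DiscreteTopology V₁ := ⟨rfl⟩
  have hq : Continuous (quotMap f hf) :=
    isQuotientMap_quot_mk.continuous_iff.2 (continuous_quot_mk.comp hfc)
  exact hfc.sumMap (continuous_of_discreteTopology.prodMap hq)

theorem map_symm_map [IsBooleanGroup V₁] [IsBooleanGroup U₁] (g : V₁ ≃* V₂)
    (f : U₁ →* U₂) (f' : U₂ →* U₁) (hf : f s₁ = s₂) (hf' : f' s₂ = s₁) (h : ∀ u, f' (f u) = u)
    (x : SpecialY V₁ U₁ s₁) :
    map g.symm f' hf' (map g f hf x) = x := by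
  induction x using ind with
  | h₁ a => rw [map_ofU, map_ofU, h]
  | h₂ v a =>
    rw [map_ofVW, map_ofVW, quotMap_mk, quotMap_mk, h]
    simp

variable [IsBooleanGroup V₁] [IsBooleanGroup U₁] [IsBooleanGroup V₂] [IsBooleanGroup U₂]

theorem map_mul_map (g : V₁ ≃* V₂) (f : U₁ →* U₂) (hf : f s₁ = s₂) (x y : SpecialY V₁ U₁ s₁) :
    mul (map g f hf x) (map g f hf y) = (mul x y).map (map g f hf) := by
  induction x using ind with
  | h₁ a =>
    induction y using ind with
    | h₁ b => simp [map_ofU, mul_ofU_ofU]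
    | h₂ w b => simp [map_ofU, map_ofVW, mul_ofU_ofVW, quotMap_mk]
  | h₂ v a =>
    induction y using ind with
    | h₁ b => simp [map_ofU, map_ofVW, mul_ofVW_ofU, quotMap_mk]
    | h₂ w b =>
      by_cases e : v = w
      · subst e
        simp [map_ofU, map_ofVW, mul_ofVW_self, ← QuotientGroup.mk_mul, quotMap_mk, fiber_mk, hf]
      · rw [map_ofVW, map_ofVW, mul_ofVW_ofVW e, mul_ofVW_ofVW, Sym2.map_mk, map_ofVW]
        · simp
        · intro h
          exact e (Subtype.ext (g.injective (congrArg Subtype.val h)))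

/-- The isomorphism of models induced by isomorphisms of the data. -/
def mapIso [TopologicalSpace U₁] [TopologicalSpace U₂] (g : V₁ ≃* V₂)
    (f : U₁ ≃ₜ* U₂) (hf : f s₁ = s₂) :
    TopTwoValuedIso (SpecialY V₁ U₁ s₁) (SpecialY V₂ U₂ s₂) where
  toFun := map g f hf
  invFun := map g.symm f.symm (f.symm_apply_eq.2 hf.symm)
  left_inv := map_symm_map g (f : U₁ →* U₂) (f.symm : U₂ →* U₁) _ _ f.symm_apply_apply
  right_inv := map_symm_map g.symm (f.symm : U₂ →* U₁) (f : U₁ →* U₂) _ _ f.apply_symm_apply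
  continuous_toFun := continuous_map g (f : U₁ →* U₂) hf f.continuous
  continuous_invFun := continuous_map g.symm (f.symm : U₂ →* U₁) _ f.symm.continuous
  map_mul := map_mul_map g (f : U₁ →* U₂) hf
  map_one := congrArg ofU (map_one f)
  map_inv _ := rfl

end

end SpecialY

theorem mainTheorem10 :
    (∀ (X : Type u) [TopologicalSpace X] [T2Space X] [TwoValuedGroup X]
        [IsTopologicalTwoValuedGroup X],
      TwoValuedGroup.IsInvolutive X → TwoValuedGroup.IsCommutative X →
      TwoValuedGroup.IsSpecial X →
      ∃ (V U : Type u) (_ : CommGroup V) (_ : IsBooleanGroup V)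
        (_ : CommGroup U) (_ : IsBooleanGroup U) (_ : TopologicalSpace U)
        (_ : IsTopologicalGroup U) (_ : T2Space U) (s : U),
        2 ≤ IsBooleanGroup.dim V ∧ s ≠ 1 ∧ Nonempty (TopTwoValuedIso X (SpecialY V U s))) ∧
    (∀ (V₁ : Type v₁) (U₁ : Type u₁) (V₂ : Type v₂) (U₂ : Type u₂)
        [CommGroup V₁] [IsBooleanGroup V₁] [CommGroup U₁] [IsBooleanGroup U₁]
        [TopologicalSpace U₁] [IsTopologicalGroup U₁] [T2Space U₁]
        [CommGroup V₂] [IsBooleanGroup V₂] [CommGroup U₂] [IsBooleanGroup U₂]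
        [TopologicalSpace U₂] [IsTopologicalGroup U₂] [T2Space U₂]
        (s₁ : U₁) (s₂ : U₂),
      2 ≤ IsBooleanGroup.dim V₁ → s₁ ≠ 1 → 2 ≤ IsBooleanGroup.dim V₂ → s₂ ≠ 1 →
      (Nonempty (TopTwoValuedIso (SpecialY V₁ U₁ s₁) (SpecialY V₂ U₂ s₂)) ↔
        Nonempty (V₁ ≃* V₂) ∧ ∃ f : U₁ ≃ₜ* U₂, f s₁ = s₂)) := by
  refine ⟨fun X _ _ _ _ hi hc hs => exists_specialY_iso X hi hc hs, ?_⟩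
  intro V₁ U₁ V₂ U₂ _ _ _ _ _ _ _ _ _ _ _ _ _ _ s₁ s₂ hV₁ hs₁ _ hs₂
  constructor
  · rintro ⟨φ⟩
    exact ⟨SpecialY.nonempty_mulEquiv_of_iso hs₁ hs₂ φ,
      SpecialY.exists_continuousMulEquiv_of_iso hs₁ hs₂
        (IsBooleanGroup.exists_ne_one_of_two_le_dim hV₁) φ⟩
  · rintro ⟨⟨g⟩, f, hf⟩
    exact ⟨SpecialY.mapIso g f hf⟩
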